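/- Let $M$ be a smooth manifold and let $D\subset TM\oplus T^*M$ be a Dirac structure, i.e. a smooth subbundle of rank $\dim M$ that is isotropic for $\langle (v,\alpha),(w,\beta)\rangle=\alpha(w)+\beta(v)$ and whose smooth sections are closed under the Courant bracket $$[(X,\alpha),(Y,\beta)]=\big([X,Y],\,L_X\beta-L_Y\alpha-\tfrac12 d(\beta(X)-\alpha(Y))\big).$$ With this bracket and the anchor $\rho(v,\alpha)=v$, $D$ is a Lie algebroid; let $d_D$ be its differential on $\Gamma(\Lambda^\bullet D^*)$. Let $\Gamma(\Lambda^kD^*)^{hor}$ be the space of smooth $k$-forms $\eta$ on $D$ such that $\eta_m$ and $(d_D\eta)_m$ are annihilated by contraction with every element of $\ker\rho_m$, for all $m\in M$, and let $$\mathcal H^2_{hor}(D)=\frac{\ker\big(d_D:\Gamma(\Lambda^2D^*)^{hor}\to\Gamma(\Lambda^3D^*)^{hor}\big)}{d_D\big(\Gamma(D^*)^{hor}\big)}.$$ A leaf of $D$ is a maximal connected injectively immersed submanifold $\iota:L\to M$ with $TL=\rho(D)|_L$ (a leaf of the singular foliation induced by $\rho(D)$). Define $\omega_D((v,\alpha),(w,\beta))=\alpha(w)-\beta(v)$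 for $(v,\alpha),(w,\beta)\in D_m$. Then: 1. $\omega_D\in\Gamma(\Lambda^2D^*)^{hor}$ and $d_D\omega_D=0$, so $\omega_D$ defines a class $[\omega_D]\in\mathcal H^2_{hor}(D)$. 2. On every leaf $\iota: L\to M$ of $D$, $\omega_D$ induces a smooth closed 2-form $(\omega_D)_L$, given by $(\omega_D)_L(u,v)=\omega_D(a,b)$ whenever $\rho(a)=d\iota(u)$ and $\rho(b)=d\iota(v)$. If $[\omega_D]=0$ in $\mathcal H^2_{hor}(D)$, then $[(\omega_D)_L]=0$ in $H^2_{dR}(L)$ for every leaf $L$ of $D$. -/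

import Mathlib

open scoped Manifold ContDiff Topology

set_option linter.unusedSectionVars false

noncomputable section

namespace Dirac

/-! ### Vector fields, differential forms and de Rham cohomology in degree two -/

section DeRham

variable (E : Type*) [NormedAddCommGroup E] [NormedSpace ℝ E]
variable (M : Type*) [TopologicalSpace M] [ChartedSpace E M] [IsManifold 𝓘(ℝ, E) ∞ M]

/-- Smooth vector fields on `M`. -/
abbrev VectorFields : Type _ :=
  Cₛ^∞⟮𝓘(ℝ, E); E, fun m : M => TangentSpace 𝓘(ℝ, E) m⟯

/-- Smooth 1-forms on `M`: smooth sections of the cotangent bundle. -/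
abbrev OneForms : Type _ :=
  Cₛ^∞⟮𝓘(ℝ, E); E →L[ℝ] ℝ, fun m : M => TangentSpace 𝓘(ℝ, E) m →L[ℝ] ℝ⟯

/-- Smooth covariant 2-tensors on `M`. -/
abbrev TwoTensors : Type _ :=
  Cₛ^∞⟮𝓘(ℝ, E); E →L[ℝ] E →L[ℝ] ℝ,
    fun m : M => TangentSpace 𝓘(ℝ, E) m →L[ℝ] TangentSpace 𝓘(ℝ, E) m →L[ℝ] ℝ⟯

set_option synthInstance.maxHeartbeats 400000 in
instance : AddCommGroup (OneForms E M) := inferInstance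

set_option synthInstance.maxHeartbeats 400000 in
instance : Module ℝ (OneForms E M) := inferInstance

set_option synthInstance.maxHeartbeats 400000 in
instance : AddCommGroup (TwoTensors E M) := inferInstance

set_option synthInstance.maxHeartbeats 400000 in
instance : Module ℝ (TwoTensors E M) := inferInstance

set_option synthInstance.maxHeartbeats 400000 in
instance : Zero (OneForms E M) := inferInstance

set_option synthInstance.maxHeartbeats 400000 in
instance : Zero (TwoTensors E M) := inferInstance

variable {E M}

/-- `(dθ)(X, Y) = X(θ(Y)) - Y(θ(X)) - θ([X, Y])`. -/
def dOneForm (θ : OneForms E M) (X Y : VectorFields E M) (m : M) : ℝ :=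
  mvfderiv 𝓘(ℝ, E) (fun p => θ p (Y p)) m (X m)
    - mvfderiv 𝓘(ℝ, E) (fun p => θ p (X p)) m (Y m)
    - θ m (VectorField.mlieBracket 𝓘(ℝ, E) X Y m)

/-- `(dη)(X, Y, Z) = X(η(Y, Z)) - Y(η(X, Z)) + Z(η(X, Y))
  - η([X, Y], Z) + η([X, Z], Y) - η([Y, Z], X)`. -/
def dTwoForm (η : TwoTensors E M) (X Y Z : VectorFields E M) (m : M) : ℝ :=
  mvfderiv 𝓘(ℝ, E) (fun p => η p (Y p) (Z p)) m (X m)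
    - mvfderiv 𝓘(ℝ, E) (fun p => η p (X p) (Z p)) m (Y m)
    + mvfderiv 𝓘(ℝ, E) (fun p => η p (X p) (Y p)) m (Z m)
    - η m (VectorField.mlieBracket 𝓘(ℝ, E) X Y m) (Z m)
    + η m (VectorField.mlieBracket 𝓘(ℝ, E) X Z m) (Y m)
    - η m (VectorField.mlieBracket 𝓘(ℝ, E) Y Z m) (X m)

lemma mvfderiv_fun_add {f g : M → ℝ} {m : M} (hf : MDifferentiableAt 𝓘(ℝ, E) 𝓘(ℝ, ℝ) f m)
    (hg : MDifferentiableAt 𝓘(ℝ, E) 𝓘(ℝ, ℝ) g m) (v : TangentSpace 𝓘(ℝ, E) m) :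
    mvfderiv 𝓘(ℝ, E) (fun p => f p + g p) m v
      = mvfderiv 𝓘(ℝ, E) f m v + mvfderiv 𝓘(ℝ, E) g m v :=
  congrArg (fun A => A v) (mvfderiv_add hf hg)

lemma mvfderiv_fun_mul {f g : M → ℝ} {m : M} (hf : MDifferentiableAt 𝓘(ℝ, E) 𝓘(ℝ, ℝ) f m)
    (hg : MDifferentiableAt 𝓘(ℝ, E) 𝓘(ℝ, ℝ) g m) (v : TangentSpace 𝓘(ℝ, E) m) :
    mvfderiv 𝓘(ℝ, E) (fun p => f p * g p) m v
      = f m * mvfderiv 𝓘(ℝ, E) g m v + g m * mvfderiv 𝓘(ℝ, E) f m v :=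
  congrArg (fun A => A v) (mvfderiv_mul hf hg)

lemma mvfderiv_fun_const_mul {f : M → ℝ} {m : M}
    (hf : MDifferentiableAt 𝓘(ℝ, E) 𝓘(ℝ, ℝ) f m) (c : ℝ) (v : TangentSpace 𝓘(ℝ, E) m) :
    mvfderiv 𝓘(ℝ, E) (fun p => c * f p) m v = c * mvfderiv 𝓘(ℝ, E) f m v := by
  rw [mvfderiv_fun_mul mdifferentiableAt_const hf, mvfderiv_const]
  simp

lemma mvfderiv_fun_zero (m : M) (v : TangentSpace 𝓘(ℝ, E) m) :
    mvfderiv 𝓘(ℝ, E) (fun _ : M => (0 : ℝ)) m v = 0 := by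
  rw [mvfderiv_const]; rfl

lemma mdifferentiableAt_oneForm_apply (θ : OneForms E M)
    {Y : Π m : M, TangentSpace 𝓘(ℝ, E) m} {m : M}
    (hY : MDifferentiableAt 𝓘(ℝ, E) 𝓘(ℝ, E).tangent
      (fun p => Bundle.TotalSpace.mk' E p (Y p)) m) :
    MDifferentiableAt 𝓘(ℝ, E) 𝓘(ℝ, ℝ) (fun p => θ p (Y p)) m := by
  have h := MDifferentiableAt.clm_bundle_apply (F₂ := ℝ) (E₂ := fun _ : M => ℝ)
    (θ.mdifferentiableAt (x := m)) hY
  exact ((mdifferentiableAt_totalSpace _ _).1 h).2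

lemma mdifferentiableAt_twoTensor_apply (η : TwoTensors E M) (X Y : VectorFields E M) (m : M) :
    MDifferentiableAt 𝓘(ℝ, E) 𝓘(ℝ, ℝ) (fun p => η p (X p) (Y p)) m := by
  have h := MDifferentiableAt.clm_bundle_apply₂ (F₃ := ℝ) (E₃ := fun _ : M => ℝ)
    (η.mdifferentiableAt (x := m)) (X.mdifferentiableAt (x := m)) (Y.mdifferentiableAt (x := m))
  exact ((mdifferentiableAt_totalSpace _ _).1 h).2

variable (E M)

/-- The space of smooth closed 2-forms on `M`. -/
def closedTwoForms : Submodule ℝ (TwoTensors E M) where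
  carrier := {η | (∀ m v, η m v v = 0) ∧ ∀ X Y Z m, dTwoForm η X Y Z m = 0}
  add_mem' := by
    rintro η η' ⟨h1, h2⟩ ⟨h1', h2'⟩
    refine ⟨fun m v => ?_, fun X Y Z m => ?_⟩
    · have a := h1 m v
      have b := h1' m v
      change η m v v + η' m v v = 0
      rw [a, b, add_zero]
    · have a := h2 X Y Z m
      have b := h2' X Y Z m
      have key : ∀ U V W : VectorFields E M,
          mvfderiv 𝓘(ℝ, E) (fun p => (η + η') p (U p) (V p)) m (W m)
            = mvfderiv 𝓘(ℝ, E) (fun p => η p (U p) (V p)) m (W m)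
              + mvfderiv 𝓘(ℝ, E) (fun p => η' p (U p) (V p)) m (W m) := fun U V W =>
        mvfderiv_fun_add (mdifferentiableAt_twoTensor_apply η U V m)
          (mdifferentiableAt_twoTensor_apply η' U V m) (W m)
      have key' : ∀ u v : TangentSpace 𝓘(ℝ, E) m, (η + η') m u v = η m u v + η' m u v :=
        fun u v => rfl
      simp only [dTwoForm, key, key'] at a b ⊢
      linarith
  zero_mem' := by
    refine ⟨fun m v => rfl, fun X Y Z m => ?_⟩
    have key : ∀ U V W : VectorFields E M,
        mvfderiv 𝓘(ℝ, E) (fun p => (0 : TwoTensors E M) p (U p) (V p)) m (W m) = 0 :=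
      fun U V W => mvfderiv_fun_zero m (W m)
    have key' : ∀ u v : TangentSpace 𝓘(ℝ, E) m, (0 : TwoTensors E M) m u v = 0 :=
      fun u v => rfl
    simp only [dTwoForm, key, key']
    norm_num
  smul_mem' := by
    rintro c η ⟨h1, h2⟩
    refine ⟨fun m v => ?_, fun X Y Z m => ?_⟩
    · change c * η m v v = 0
      rw [h1 m v, mul_zero]
    · have a := h2 X Y Z m
      have key : ∀ U V W : VectorFields E M,
          mvfderiv 𝓘(ℝ, E) (fun p => (c • η) p (U p) (V p)) m (W m)
            = c * mvfderiv 𝓘(ℝ, E) (fun p => η p (U p) (V p)) m (W m) := fun U V W =>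
        mvfderiv_fun_const_mul (mdifferentiableAt_twoTensor_apply η U V m) c (W m)
      have key' : ∀ u v : TangentSpace 𝓘(ℝ, E) m, (c • η) m u v = c * η m u v :=
        fun u v => rfl
      simp only [dTwoForm, key, key'] at a ⊢
      linear_combination c * a

/-- The space of exact 2-forms, inside the space of closed ones. -/
def exactTwoForms : Submodule ℝ (closedTwoForms E M) where
  carrier := {η | ∃ θ : OneForms E M, ∀ X Y : VectorFields E M, ∀ m,
    η.1 m (X m) (Y m) = dOneForm θ X Y m}
  add_mem' := by
    rintro η η' ⟨θ, h⟩ ⟨θ', h'⟩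
    refine ⟨θ + θ', fun X Y m => ?_⟩
    have key : ∀ U V : VectorFields E M,
        mvfderiv 𝓘(ℝ, E) (fun p => (θ + θ') p (U p)) m (V m)
          = mvfderiv 𝓘(ℝ, E) (fun p => θ p (U p)) m (V m)
            + mvfderiv 𝓘(ℝ, E) (fun p => θ' p (U p)) m (V m) := fun U V =>
      mvfderiv_fun_add (mdifferentiableAt_oneForm_apply θ U.mdifferentiableAt)
        (mdifferentiableAt_oneForm_apply θ' U.mdifferentiableAt) (V m)
    have key' : ∀ u : TangentSpace 𝓘(ℝ, E) m, (θ + θ') m u = θ m u + θ' m u := fun u => rfl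
    have a := h X Y m
    have b := h' X Y m
    change η.1 m (X m) (Y m) + η'.1 m (X m) (Y m) = _
    simp only [dOneForm, key, key'] at a b ⊢
    linarith
  zero_mem' := by
    refine ⟨0, fun X Y m => ?_⟩
    have key : ∀ U V : VectorFields E M,
        mvfderiv 𝓘(ℝ, E) (fun p => (0 : OneForms E M) p (U p)) m (V m) = 0 :=
      fun U V => mvfderiv_fun_zero m (V m)
    have key' : ∀ u : TangentSpace 𝓘(ℝ, E) m, (0 : OneForms E M) m u = 0 := fun u => rfl
    change (0 : ℝ) = _
    simp only [dOneForm, key, key']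
    norm_num
  smul_mem' := by
    rintro c η ⟨θ, h⟩
    refine ⟨c • θ, fun X Y m => ?_⟩
    have key : ∀ U V : VectorFields E M,
        mvfderiv 𝓘(ℝ, E) (fun p => (c • θ) p (U p)) m (V m)
          = c * mvfderiv 𝓘(ℝ, E) (fun p => θ p (U p)) m (V m) := fun U V =>
      mvfderiv_fun_const_mul (mdifferentiableAt_oneForm_apply θ U.mdifferentiableAt) c (V m)
    have key' : ∀ u : TangentSpace 𝓘(ℝ, E) m, (c • θ) m u = c * θ m u := fun u => rfl
    have a := h X Y m
    change c * η.1 m (X m) (Y m) = _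
    simp only [dOneForm, key, key'] at a ⊢
    linear_combination c * a

/-- The de Rham cohomology `H²_dR(M)`. -/
abbrev DeRhamH2 : Type _ := closedTwoForms E M ⧸ exactTwoForms E M

variable {E M}

/-- The class of a closed 2-form in `H²_dR(M)`. -/
def deRhamClass (η : closedTwoForms E M) : DeRhamH2 E M := Submodule.Quotient.mk η

end DeRham

/-! ### The Courant bracket and Dirac structures -/

section Courant

variable {E : Type*} [NormedAddCommGroup E] [NormedSpace ℝ E] [FiniteDimensional ℝ E]
variable {M : Type*} [TopologicalSpace M] [ChartedSpace E M] [IsManifold 𝓘(ℝ, E) ∞ M]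

/-- `Z ↦ X(β(Z)) - β([X, Z])` is tensorial. -/
lemma tensorialAt_lieDeriv (X : VectorFields E M) (β : OneForms E M) (m : M) :
    TensorialAt 𝓘(ℝ, E) E (fun Z : Π p : M, TangentSpace 𝓘(ℝ, E) p =>
      mvfderiv 𝓘(ℝ, E) (fun p => β p (Z p)) m (X m)
        - β m (VectorField.mlieBracket 𝓘(ℝ, E) X Z m)) m where
  smul := by
    intro f Z hf hZ
    have h1 : (fun p => β p ((f • Z) p)) = fun p => f p * β p (Z p) := by
      funext p
      exact (β p).map_smul (f p) (Z p)
    have h2 := VectorField.mlieBracket_smul_right (V := X) hf hZ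
    simp only [h1, h2, mvfderiv_fun_mul hf (mdifferentiableAt_oneForm_apply β hZ), map_add,
      map_smul, smul_eq_mul]
    ring
  add := by
    intro Z Z' hZ hZ'
    have h1 : (fun p => β p ((Z + Z') p)) = fun p => β p (Z p) + β p (Z' p) := by
      funext p
      exact (β p).map_add (Z p) (Z' p)
    have h2 := VectorField.mlieBracket_add_right (V := X) hZ hZ'
    simp only [h1, h2, mvfderiv_fun_add (mdifferentiableAt_oneForm_apply β hZ)
      (mdifferentiableAt_oneForm_apply β hZ'), map_add]
    ring

/-- The Lie derivative of a 1-form: `(L_X β)(Z) = X(β(Z)) - β([X, Z])`. -/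
def lieDeriv (X : VectorFields E M) (β : OneForms E M) (m : M) :
    TangentSpace 𝓘(ℝ, E) m →L[ℝ] ℝ :=
  TensorialAt.mkHom _ m (tensorialAt_lieDeriv X β m)

lemma lieDeriv_apply (X : VectorFields E M) (β : OneForms E M) (Z : VectorFields E M) (m : M) :
    lieDeriv X β m (Z m) = mvfderiv 𝓘(ℝ, E) (fun p => β p (Z p)) m (X m)
      - β m (VectorField.mlieBracket 𝓘(ℝ, E) X Z m) :=
  TensorialAt.mkHom_apply (tensorialAt_lieDeriv X β m) Z.mdifferentiableAt

variable (E) in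
/-- The fibre `T_mM ⊕ T_m^*M` of the generalized tangent bundle. -/
abbrev GenTangent (m : M) : Type _ :=
  TangentSpace 𝓘(ℝ, E) m × (TangentSpace 𝓘(ℝ, E) m →L[ℝ] ℝ)

instance (m : M) : AddCommGroup (GenTangent E m) := inferInstance

instance (m : M) : AddCommMonoid (GenTangent E m) := inferInstance

instance (m : M) : Module ℝ (GenTangent E m) := inferInstance

/-- The Courant bracket
`[(X, α), (Y, β)] = ([X, Y], L_X β - L_Y α - ½ d(β(X) - α(Y)))`, as a pointwise section. -/
def courantBracket (X : VectorFields E M) (α : OneForms E M)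
    (Y : VectorFields E M) (β : OneForms E M) (m : M) : GenTangent E m :=
  (VectorField.mlieBracket 𝓘(ℝ, E) X Y m,
    lieDeriv X β m - lieDeriv Y α m
      - (1 / 2 : ℝ) • mvfderiv 𝓘(ℝ, E) (fun p => β p (X p) - α p (Y p)) m)

variable (E M) in
/-- A Dirac structure: a smooth subbundle of `TM ⊕ T^*M` of rank `dim M`, isotropic for
`⟨(v, α), (w, β)⟩ = α(w) + β(v)` and whose sections are closed under the Courant bracket. -/
structure DiracStructure where
  fiber : ∀ m : M, Submodule ℝ (GenTangent E m)
  /-- Around every point there is a smooth local frame with `dim M` elements. -/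
  exists_frame : ∀ m₀ : M, ∃ U : Set M, IsOpen U ∧ m₀ ∈ U ∧
    ∃ (X : Fin (Module.finrank ℝ E) → ∀ m : M, TangentSpace 𝓘(ℝ, E) m)
      (α : Fin (Module.finrank ℝ E) → ∀ m : M, TangentSpace 𝓘(ℝ, E) m →L[ℝ] ℝ),
      (∀ i, ContMDiffOn 𝓘(ℝ, E) (𝓘(ℝ, E).prod 𝓘(ℝ, E)) ∞
        (fun m => Bundle.TotalSpace.mk' E m (X i m)) U) ∧
      (∀ i, ContMDiffOn 𝓘(ℝ, E) (𝓘(ℝ, E).prod 𝓘(ℝ, E →L[ℝ] ℝ)) ∞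
        (fun m => Bundle.TotalSpace.mk' (E →L[ℝ] ℝ)
          (E := fun p : M => TangentSpace 𝓘(ℝ, E) p →L[ℝ] ℝ) m (α i m)) U) ∧
      ∀ m ∈ U, LinearIndependent ℝ (fun i => ((X i m, α i m) : GenTangent E m)) ∧
        Submodule.span ℝ (Set.range fun i => ((X i m, α i m) : GenTangent E m)) = fiber m
  isotropic : ∀ m, ∀ a ∈ fiber m, ∀ b ∈ fiber m, a.2 b.1 + b.2 a.1 = 0
  involutive : ∀ (X Y : VectorFields E M) (α β : OneForms E M),
    (∀ m, ((X m, α m) : GenTangent E m) ∈ fiber m) →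
    (∀ m, ((Y m, β m) : GenTangent E m) ∈ fiber m) →
    ∀ m, courantBracket X α Y β m ∈ fiber m

/-- The smooth sections `Γ(D)` of a Dirac structure. -/
structure DiracSection (D : DiracStructure E M) where
  vec : VectorFields E M
  form : OneForms E M
  mem : ∀ m, ((vec m, form m) : GenTangent E m) ∈ D.fiber m

/-- The value of a section at a point. -/
def DiracSection.eval {D : DiracStructure E M} (ξ : DiracSection D) (m : M) : D.fiber m :=
  ⟨(ξ.vec m, ξ.form m), ξ.mem m⟩

/-- The Lie algebroid bracket of `D`: the restriction of the Courant bracket. -/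
def bracket {D : DiracStructure E M} (ξ ζ : DiracSection D) (m : M) : D.fiber m :=
  ⟨courantBracket ξ.vec ξ.form ζ.vec ζ.form m,
    D.involutive _ _ _ _ ξ.mem ζ.mem m⟩

/-- The anchor `ρ : D → TM`. -/
def anchor (D : DiracStructure E M) (m : M) : D.fiber m →ₗ[ℝ] TangentSpace 𝓘(ℝ, E) m :=
  LinearMap.fst ℝ _ _ ∘ₗ (D.fiber m).subtype

end Courant

/-! ### Forms on a Dirac structure, the Lie algebroid differential, horizontal cohomology -/

section Horizontal

variable {E : Type*} [NormedAddCommGroup E] [NormedSpace ℝ E] [FiniteDimensional ℝ E]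
variable {M : Type*} [TopologicalSpace M] [ChartedSpace E M] [IsManifold 𝓘(ℝ, E) ∞ M]
variable (D : DiracStructure E M)

instance (m : M) : AddCommMonoid (D.fiber m) := inferInstance

instance (m : M) : Module ℝ (D.fiber m) := inferInstance

/-- Families of linear forms on the fibres of `D`. -/
abbrev FibreOneForms : Type _ := ∀ m, D.fiber m →ₗ[ℝ] ℝ

/-- Families of bilinear forms on the fibres of `D`. -/
abbrev FibreTwoForms : Type _ := ∀ m, D.fiber m →ₗ[ℝ] D.fiber m →ₗ[ℝ] ℝ

instance : AddCommGroup (FibreOneForms D) := inferInstance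

instance : Module ℝ (FibreOneForms D) := inferInstance

instance : AddCommGroup (FibreTwoForms D) := inferInstance

instance : Module ℝ (FibreTwoForms D) := inferInstance

/-- `Γ(D^*)`: fibrewise linear forms that take smooth sections to smooth functions. -/
def dOneForms : Submodule ℝ (FibreOneForms D) where
  carrier := {θ | ∀ ξ : DiracSection D,
    ContMDiff 𝓘(ℝ, E) 𝓘(ℝ, ℝ) ∞ (fun m => θ m (ξ.eval m))}
  add_mem' := fun h h' ξ => (h ξ).add (h' ξ)
  zero_mem' := fun _ => contMDiff_const
  smul_mem' := fun _ _ h ξ => contMDiff_const.mul (h ξ)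

/-- `Γ(Λ²D^*)`: fibrewise alternating bilinear forms that take smooth sections to smooth
functions. -/
def dTwoForms : Submodule ℝ (FibreTwoForms D) where
  carrier := {η | (∀ m a, η m a a = 0) ∧ ∀ ξ ζ : DiracSection D,
    ContMDiff 𝓘(ℝ, E) 𝓘(ℝ, ℝ) ∞ (fun m => η m (ξ.eval m) (ζ.eval m))}
  add_mem' := by
    rintro η η' ⟨h1, h2⟩ ⟨h1', h2'⟩
    refine ⟨fun m a => ?_, fun ξ ζ => (h2 ξ ζ).add (h2' ξ ζ)⟩
    simp [h1 m a, h1' m a]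
  zero_mem' := ⟨fun _ _ => rfl, fun _ _ => contMDiff_const⟩
  smul_mem' := by
    rintro c η ⟨h1, h2⟩
    refine ⟨fun m a => ?_, fun ξ ζ => contMDiff_const.mul (h2 ξ ζ)⟩
    simp [h1 m a]

variable {D}

/-- The Lie algebroid differential of a 1-form, evaluated on sections:
`(d_D θ)(ξ, ζ) = ρ(ξ)(θ(ζ)) - ρ(ζ)(θ(ξ)) - θ([ξ, ζ])`. -/
def diffOne (θ : FibreOneForms D) (ξ ζ : DiracSection D) (m : M) : ℝ :=
  mvfderiv 𝓘(ℝ, E) (fun p => θ p (ζ.eval p)) m (anchor D m (ξ.eval m))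
    - mvfderiv 𝓘(ℝ, E) (fun p => θ p (ξ.eval p)) m (anchor D m (ζ.eval m))
    - θ m (bracket ξ ζ m)

/-- The Lie algebroid differential of a 2-form, evaluated on sections:
`(d_D η)(ξ₁, ξ₂, ξ₃) = ρ(ξ₁)(η(ξ₂, ξ₃)) - ρ(ξ₂)(η(ξ₁, ξ₃)) + ρ(ξ₃)(η(ξ₁, ξ₂))
  - η([ξ₁, ξ₂], ξ₃) + η([ξ₁, ξ₃], ξ₂) - η([ξ₂, ξ₃], ξ₁)`. -/
def diffTwo (η : FibreTwoForms D) (ξ₁ ξ₂ ξ₃ : DiracSection D)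
    (m : M) : ℝ :=
  mvfderiv 𝓘(ℝ, E) (fun p => η p (ξ₂.eval p) (ξ₃.eval p)) m (anchor D m (ξ₁.eval m))
    - mvfderiv 𝓘(ℝ, E) (fun p => η p (ξ₁.eval p) (ξ₃.eval p)) m (anchor D m (ξ₂.eval m))
    + mvfderiv 𝓘(ℝ, E) (fun p => η p (ξ₁.eval p) (ξ₂.eval p)) m (anchor D m (ξ₃.eval m))
    - η m (bracket ξ₁ ξ₂ m) (ξ₃.eval m) + η m (bracket ξ₁ ξ₃ m) (ξ₂.eval m)
    - η m (bracket ξ₂ ξ₃ m) (ξ₁.eval m)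

lemma diffOne_add {θ θ' : FibreOneForms D} (h : θ ∈ dOneForms D)
    (h' : θ' ∈ dOneForms D) (ξ ζ : DiracSection D) (m : M) :
    diffOne (θ + θ') ξ ζ m = diffOne θ ξ ζ m + diffOne θ' ξ ζ m := by
  have key : ∀ (ξ : DiracSection D) (v : TangentSpace 𝓘(ℝ, E) m),
      mvfderiv 𝓘(ℝ, E) (fun p => (θ + θ') p (ξ.eval p)) m v
        = mvfderiv 𝓘(ℝ, E) (fun p => θ p (ξ.eval p)) m v
          + mvfderiv 𝓘(ℝ, E) (fun p => θ' p (ξ.eval p)) m v := fun ξ v =>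
    mvfderiv_fun_add ((h ξ).mdifferentiable (by simp) m)
      ((h' ξ).mdifferentiable (by simp) m) v
  have key' : ∀ a, (θ + θ') m a = θ m a + θ' m a := fun a => rfl
  simp only [diffOne, key, key']
  ring

lemma diffOne_smul {θ : FibreOneForms D} (h : θ ∈ dOneForms D) (c : ℝ)
    (ξ ζ : DiracSection D) (m : M) : diffOne (c • θ) ξ ζ m = c * diffOne θ ξ ζ m := by
  have key : ∀ (ξ : DiracSection D) (v : TangentSpace 𝓘(ℝ, E) m),
      mvfderiv 𝓘(ℝ, E) (fun p => (c • θ) p (ξ.eval p)) m v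
        = c * mvfderiv 𝓘(ℝ, E) (fun p => θ p (ξ.eval p)) m v := fun ξ v =>
    mvfderiv_fun_const_mul ((h ξ).mdifferentiable (by simp) m) c v
  have key' : ∀ a, (c • θ) m a = c * θ m a := fun a => rfl
  simp only [diffOne, key, key']
  ring

lemma diffOne_zero (ξ ζ : DiracSection D) (m : M) :
    diffOne (0 : FibreOneForms D) ξ ζ m = 0 := by
  have h := diffOne_smul (zero_mem (dOneForms D)) 0 ξ ζ m
  rwa [zero_smul, zero_mul] at h

lemma diffTwo_add {η η' : FibreTwoForms D} (h : η ∈ dTwoForms D)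
    (h' : η' ∈ dTwoForms D) (ξ₁ ξ₂ ξ₃ : DiracSection D) (m : M) :
    diffTwo (η + η') ξ₁ ξ₂ ξ₃ m = diffTwo η ξ₁ ξ₂ ξ₃ m + diffTwo η' ξ₁ ξ₂ ξ₃ m := by
  have key : ∀ (ξ ζ : DiracSection D) (v : TangentSpace 𝓘(ℝ, E) m),
      mvfderiv 𝓘(ℝ, E) (fun p => (η + η') p (ξ.eval p) (ζ.eval p)) m v
        = mvfderiv 𝓘(ℝ, E) (fun p => η p (ξ.eval p) (ζ.eval p)) m v
          + mvfderiv 𝓘(ℝ, E) (fun p => η' p (ξ.eval p) (ζ.eval p)) m v := fun ξ ζ v =>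
    mvfderiv_fun_add ((h.2 ξ ζ).mdifferentiable (by simp) m)
      ((h'.2 ξ ζ).mdifferentiable (by simp) m) v
  have key' : ∀ a b, (η + η') m a b = η m a b + η' m a b := fun a b => rfl
  simp only [diffTwo, key, key']
  ring

lemma diffTwo_smul {η : FibreTwoForms D} (h : η ∈ dTwoForms D)
    (c : ℝ) (ξ₁ ξ₂ ξ₃ : DiracSection D) (m : M) :
    diffTwo (c • η) ξ₁ ξ₂ ξ₃ m = c * diffTwo η ξ₁ ξ₂ ξ₃ m := by
  have key : ∀ (ξ ζ : DiracSection D) (v : TangentSpace 𝓘(ℝ, E) m),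
      mvfderiv 𝓘(ℝ, E) (fun p => (c • η) p (ξ.eval p) (ζ.eval p)) m v
        = c * mvfderiv 𝓘(ℝ, E) (fun p => η p (ξ.eval p) (ζ.eval p)) m v := fun ξ ζ v =>
    mvfderiv_fun_const_mul ((h.2 ξ ζ).mdifferentiable (by simp) m) c v
  have key' : ∀ a b, (c • η) m a b = c * η m a b := fun a b => rfl
  simp only [diffTwo, key, key']
  ring

lemma diffTwo_zero (ξ₁ ξ₂ ξ₃ : DiracSection D) (m : M) :
    diffTwo (0 : FibreTwoForms D) ξ₁ ξ₂ ξ₃ m = 0 := by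
  have h := diffTwo_smul (zero_mem (dTwoForms D)) 0 ξ₁ ξ₂ ξ₃ m
  rwa [zero_smul, zero_mul] at h

variable (D)

/-- The space `Γ(D^*)^hor`: the smooth 1-forms `θ` on `D` such that `θ_m` and `(d_D θ)_m` are
annihilated by contraction with `ker ρ_m` at every point `m`. Every vector of `D_m` is the value
of a smooth section, so the tensor `(d_D θ)_m` is tested on sections. -/
def horOneForms : Submodule ℝ (FibreOneForms D) where
  carrier := {θ | θ ∈ dOneForms D ∧
    (∀ m, ∀ a : D.fiber m, anchor D m a = 0 → θ m a = 0) ∧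
    (∀ m, ∀ ξ ζ : DiracSection D, anchor D m (ξ.eval m) = 0 → diffOne θ ξ ζ m = 0)}
  add_mem' := by
    rintro θ θ' ⟨h0, h1, h2⟩ ⟨h0', h1', h2'⟩
    refine ⟨add_mem h0 h0', fun m a ha => ?_, fun m ξ ζ hξ => ?_⟩
    · simp [h1 m a ha, h1' m a ha]
    · rw [diffOne_add h0 h0', h2 m ξ ζ hξ, h2' m ξ ζ hξ, add_zero]
  zero_mem' := ⟨zero_mem _, fun _ _ _ => rfl, fun m ξ ζ _ => diffOne_zero ξ ζ m⟩
  smul_mem' := by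
    rintro c θ ⟨h0, h1, h2⟩
    refine ⟨Submodule.smul_mem _ c h0, fun m a ha => ?_, fun m ξ ζ hξ => ?_⟩
    · simp [h1 m a ha]
    · rw [diffOne_smul h0, h2 m ξ ζ hξ, mul_zero]

/-- The space `Γ(Λ²D^*)^hor`: the smooth 2-forms `η` on `D` such that `η_m` and `(d_D η)_m` are
annihilated by contraction with `ker ρ_m` at every point `m`. As for 1-forms, `(d_D η)_m` is
tested on sections. -/
def horTwoForms : Submodule ℝ (FibreTwoForms D) where
  carrier := {η | η ∈ dTwoForms D ∧
    (∀ m, ∀ a : D.fiber m, anchor D m a = 0 → ∀ b, η m a b = 0) ∧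
    (∀ m, ∀ ξ₁ ξ₂ ξ₃ : DiracSection D, anchor D m (ξ₁.eval m) = 0 →
      diffTwo η ξ₁ ξ₂ ξ₃ m = 0)}
  add_mem' := by
    rintro η η' ⟨h0, h1, h2⟩ ⟨h0', h1', h2'⟩
    refine ⟨add_mem h0 h0', fun m a ha b => ?_, fun m ξ₁ ξ₂ ξ₃ hξ => ?_⟩
    · simp [h1 m a ha b, h1' m a ha b]
    · rw [diffTwo_add h0 h0', h2 m ξ₁ ξ₂ ξ₃ hξ, h2' m ξ₁ ξ₂ ξ₃ hξ, add_zero]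
  zero_mem' := ⟨zero_mem _, fun _ _ _ _ => rfl, fun m ξ₁ ξ₂ ξ₃ _ => diffTwo_zero ξ₁ ξ₂ ξ₃ m⟩
  smul_mem' := by
    rintro c η ⟨h0, h1, h2⟩
    refine ⟨Submodule.smul_mem _ c h0, fun m a ha b => ?_, fun m ξ₁ ξ₂ ξ₃ hξ => ?_⟩
    · simp [h1 m a ha b]
    · rw [diffTwo_smul h0, h2 m ξ₁ ξ₂ ξ₃ hξ, mul_zero]

/-- Horizontal 2-cocycles: the kernel of `d_D` on `Γ(Λ²D^*)^hor`. -/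
def horTwoCocycles : Submodule ℝ (FibreTwoForms D) where
  carrier := {η | η ∈ horTwoForms D ∧
    ∀ (ξ₁ ξ₂ ξ₃ : DiracSection D) (m : M), diffTwo η ξ₁ ξ₂ ξ₃ m = 0}
  add_mem' := by
    rintro η η' ⟨h0, h1⟩ ⟨h0', h1'⟩
    refine ⟨add_mem h0 h0', fun ξ₁ ξ₂ ξ₃ m => ?_⟩
    rw [diffTwo_add h0.1 h0'.1, h1, h1', add_zero]
  zero_mem' := ⟨zero_mem _, diffTwo_zero⟩
  smul_mem' := by
    rintro c η ⟨h0, h1⟩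
    refine ⟨Submodule.smul_mem _ c h0, fun ξ₁ ξ₂ ξ₃ m => ?_⟩
    rw [diffTwo_smul h0.1, h1, mul_zero]

variable {D} in
lemma val_add_apply (η η' : horTwoCocycles D) (m : M) (a b : D.fiber m) :
    (η + η').1 m a b = η.1 m a b + η'.1 m a b := rfl

variable {D} in
lemma val_zero_apply (m : M) (a b : D.fiber m) :
    (0 : horTwoCocycles D).1 m a b = 0 := rfl

variable {D} in
lemma val_smul_apply (c : ℝ) (η : horTwoCocycles D) (m : M) (a b : D.fiber m) :
    (c • η).1 m a b = c * η.1 m a b := rfl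

/-- Horizontal 2-coboundaries: the image of `d_D` on `Γ(D^*)^hor`, inside the cocycles. -/
def horTwoCoboundaries : Submodule ℝ (horTwoCocycles D) where
  carrier := {η | ∃ θ ∈ horOneForms D, ∀ (ξ ζ : DiracSection D) (m : M),
    η.1 m (ξ.eval m) (ζ.eval m) = diffOne θ ξ ζ m}
  add_mem' := by
    rintro η η' ⟨θ, hθ, h⟩ ⟨θ', hθ', h'⟩
    refine ⟨θ + θ', add_mem hθ hθ', fun ξ ζ m => ?_⟩
    rw [diffOne_add hθ.1 hθ'.1, ← h, ← h']
    exact val_add_apply _ _ _ _ _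
  zero_mem' := by
    refine ⟨0, zero_mem _, fun ξ ζ m => ?_⟩
    rw [diffOne_zero]
    exact val_zero_apply _ _ _
  smul_mem' := by
    intro c η hη
    obtain ⟨θ, hθ, h⟩ := hη
    refine ⟨c • θ, Submodule.smul_mem _ c hθ, fun ξ ζ m => ?_⟩
    rw [diffOne_smul hθ.1, ← h]
    exact val_smul_apply _ _ _ _ _

/-- The horizontal cohomology `H²_hor(D)`. -/
abbrev HorH2 : Type _ := horTwoCocycles D ⧸ horTwoCoboundaries D

variable {D} in
/-- The class of a horizontal 2-cocycle in `H²_hor(D)`. -/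
def horClass (η : horTwoCocycles D) : HorH2 D := Submodule.Quotient.mk η

/-- The 2-form `ω_D((v, α), (w, β)) = α(w) - β(v)`. -/
def omega : FibreTwoForms D := fun _ =>
  LinearMap.mk₂ ℝ (fun a b => a.1.2 b.1.1 - b.1.2 a.1.1)
    (fun a a' b => by simp; ring) (fun _ a b => by simp; ring)
    (fun a b b' => by simp; ring) (fun _ a b => by simp; ring)

end Horizontal

/-! ### Leaves -/

section Leaves

variable {E : Type*} [NormedAddCommGroup E] [NormedSpace ℝ E] [FiniteDimensional ℝ E]
variable {M : Type*} [TopologicalSpace M] [ChartedSpace E M] [IsManifold 𝓘(ℝ, E) ∞ M]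
variable {F : Type*} [NormedAddCommGroup F] [NormedSpace ℝ F]
variable {L : Type*} [TopologicalSpace L] [ChartedSpace F L] [IsManifold 𝓘(ℝ, F) ∞ L]

/-- `ι : L → M` is a leaf of the foliation induced by `D`: a connected, injectively immersed
submanifold with `TL = ρ(D)|_L` which is maximal, in the sense that it contains every integral
curve, of the vector field underlying a section of `D`, that it meets. -/
structure IsLeaf (D : DiracStructure E M) (ι : L → M) : Prop where
  connected : ConnectedSpace L
  contMDiff : ContMDiff 𝓘(ℝ, F) 𝓘(ℝ, E) ∞ ι
  injective : Function.Injective ι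
  immersion : ∀ x, Function.Injective (mfderiv 𝓘(ℝ, F) 𝓘(ℝ, E) ι x)
  tangent : ∀ (x : L) (v : TangentSpace 𝓘(ℝ, E) (ι x)),
    (∃ u, mfderiv 𝓘(ℝ, F) 𝓘(ℝ, E) ι x u = v) ↔ ∃ a, anchor D (ι x) a = v
  saturated : ∀ (ξ : DiracSection D) (γ : ℝ → M) (a b : ℝ),
    IsMIntegralCurveOn γ ξ.vec (Set.Ioo a b) → ∀ t₀ ∈ Set.Ioo a b, γ t₀ ∈ Set.range ι →
    ∀ t ∈ Set.Ioo a b, γ t ∈ Set.range ι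

/-- `σ` is the 2-form `η_L` induced on `L` by the 2-form `η` on `D`:
`η_L(u, v) = η(a, b)` whenever `ρ(a) = dι(u)` and `ρ(b) = dι(v)`. -/
def IsInduced {D : DiracStructure E M} (η : FibreTwoForms D)
    (ι : L → M) (σ : TwoTensors F L) : Prop :=
  ∀ (x : L) (u v : TangentSpace 𝓘(ℝ, F) x) (a b : D.fiber (ι x)),
    anchor D (ι x) a = mfderiv 𝓘(ℝ, F) 𝓘(ℝ, E) ι x u →
    anchor D (ι x) b = mfderiv 𝓘(ℝ, F) 𝓘(ℝ, E) ι x v →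
    σ x u v = η (ι x) a b

/-- On a leaf there is at most one induced 2-form. -/
lemma IsInduced.unique {D : DiracStructure E M}
    {η : FibreTwoForms D} {ι : L → M} (hι : IsLeaf (F := F) D ι)
    {σ σ' : TwoTensors F L} (h : IsInduced η ι σ) (h' : IsInduced η ι σ') : σ = σ' := by
  ext1 x
  refine ContinuousLinearMap.ext fun u => ContinuousLinearMap.ext fun v => ?_
  obtain ⟨a, ha⟩ := (hι.tangent x _).1 ⟨u, rfl⟩
  obtain ⟨b, hb⟩ := (hι.tangent x _).1 ⟨v, rfl⟩
  rw [h x u v a b ha hb, h' x u v a b ha hb]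

end Leaves

end Dirac

end

noncomputable section

namespace Dirac

/-! ### Isotropy and closedness of the 2-form `omega` -/

section Cocycle

variable {E : Type*} [NormedAddCommGroup E] [NormedSpace ℝ E] [FiniteDimensional ℝ E]
variable {M : Type*} [TopologicalSpace M] [ChartedSpace E M] [IsManifold 𝓘(ℝ, E) ∞ M]
variable (D : DiracStructure E M)

/-! Isotropy makes the two terms of `omega` opposite, so that on `D` the form is `2 α(w)`. If `v =
0`, isotropy leaves `α(w) = 0`, hence `omega` annihilates `ker ρ`. Closedness is isotropy once more:
the pairing of `ξ₃` with the Courant bracket of `ξ₁` and `ξ₂` vanishes, and expanding this pairing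
gives exactly half of `d_D ω (ξ₁, ξ₂, ξ₃)` (`diffTwo_omega`).

A tangent vector of a leaf lifts through the anchor, uniquely up to `ker ρ`, so a form annihilated
by `ker ρ` descends to the leaf. Its smoothness is tested on restrictions of sections. Local frames
of `D`, cut off by bump functions, are global sections; their vector parts are tangent to the leaf,
restrict to smooth fields because `ι` is an immersion (`contMDiffAt_of_related`), and span its
tangent spaces (`IsLeaf.exists_frame`).

Brackets of `ι`-related fields are `ι`-related (`mfderiv_mlieBracket_of_related`) and the anchor
respects brackets. On restricted sections the de Rham differential of a descended form is therefore
`d_D` of the original one, and tensoriality extends this to all vector fields. Thus `omega` descends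
to a closed form, and a horizontal primitive of `omega` descends to a primitive on every leaf. -/

lemma omega_apply (m : M) (a b : D.fiber m) :
    omega D m a b = a.1.2 b.1.1 - b.1.2 a.1.1 := rfl

/-- Isotropy says `β(v) = -α(w)`, so both terms of `omega` contribute equally. -/
lemma omega_eq_two_mul (m : M) (a b : D.fiber m) : omega D m a b = 2 * a.1.2 b.1.1 := by
  have h := D.isotropic m a.1 a.2 b.1 b.2
  rw [omega_apply]
  linarith

lemma contMDiff_oneForm_apply (α : OneForms E M) (X : VectorFields E M) :
    ContMDiff 𝓘(ℝ, E) 𝓘(ℝ, ℝ) ∞ (fun p => α p (X p)) := by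
  intro m
  have h := ContMDiffAt.clm_bundle_apply (F₂ := ℝ) (E₂ := fun _ : M => ℝ)
    (α.contMDiff m) (X.contMDiff m)
  exact (Bundle.contMDiffAt_totalSpace.1 h).2

lemma omega_mem_dTwoForms : omega D ∈ dTwoForms D := by
  refine ⟨fun m a => sub_self _, fun ξ ζ => ?_⟩
  exact (contMDiff_oneForm_apply ξ.form ζ.vec).sub (contMDiff_oneForm_apply ζ.form ξ.vec)

/-- With a vanishing vector part, the isotropy relation against `b` reduces to `α(w) = 0`. -/
lemma omega_apply_of_anchor_eq_zero (m : M) (a : D.fiber m) (ha : anchor D m a = 0)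
    (b : D.fiber m) : omega D m a b = 0 := by
  have h := D.isotropic m a.1 a.2 b.1 b.2
  have ha' : a.1.1 = 0 := ha
  rw [ha', map_zero, add_zero] at h
  rw [omega_eq_two_mul, h, mul_zero]

/-- This is twice the relation `⟨ξ₃, [ξ₁, ξ₂]⟩ = 0`, valid because the bracket stays in the
isotropic bundle `D`. -/
lemma diffTwo_omega (ξ₁ ξ₂ ξ₃ : DiracSection D) (m : M) :
    diffTwo (omega D) ξ₁ ξ₂ ξ₃ m = 0 := by
  have iso : ∀ (ξ ζ : DiracSection D) (p : M),
      ζ.form p (ξ.vec p) = - ξ.form p (ζ.vec p) := fun ξ ζ p => by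
    have := D.isotropic p _ (ξ.mem p) _ (ζ.mem p)
    dsimp only at this
    linarith
  have hd : ∀ ξ ζ : DiracSection D,
      MDifferentiableAt 𝓘(ℝ, E) 𝓘(ℝ, ℝ) (fun p => ξ.form p (ζ.vec p)) m := fun ξ ζ =>
    mdifferentiableAt_oneForm_apply ξ.form ζ.vec.mdifferentiableAt
  have key : ∀ (ξ ζ : DiracSection D) (v : TangentSpace 𝓘(ℝ, E) m),
      mvfderiv 𝓘(ℝ, E) (fun p => omega D p (ξ.eval p) (ζ.eval p)) m v
        = 2 * mvfderiv 𝓘(ℝ, E) (fun p => ξ.form p (ζ.vec p)) m v := fun ξ ζ v => by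
    rw [← mvfderiv_fun_const_mul (hd ξ ζ)]
    congr 2
    funext p
    exact omega_eq_two_mul D p _ _
  -- Isotropy against `τ` trades the form part of the bracket for its vector part, so no Lie
  -- derivative of a form enters the three bracket terms.
  have key2 : ∀ (ξ ζ τ : DiracSection D),
      omega D m (bracket ξ ζ m) (τ.eval m)
        = - (2 * τ.form m (VectorField.mlieBracket 𝓘(ℝ, E) ξ.vec ζ.vec m)) :=
      fun ξ ζ τ => by
    have h := D.isotropic m _ (τ.mem m) _ (bracket ξ ζ m).2
    rw [omega_eq_two_mul]
    change τ.form m (VectorField.mlieBracket 𝓘(ℝ, E) ξ.vec ζ.vec m) +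
      (bracket ξ ζ m).1.2 (τ.vec m) = 0 at h
    change 2 * (bracket ξ ζ m).1.2 (τ.vec m) = _
    linarith
  -- The only relation whose form part is expanded; by `e`, the term `-½ d(β(X) - α(Y))` becomes
  -- `d(α(Y))`.
  have h := D.isotropic m _ (ξ₃.mem m) _ (bracket ξ₁ ξ₂ m).2
  have e : mvfderiv 𝓘(ℝ, E) (fun p => ξ₂.form p (ξ₁.vec p) - ξ₁.form p (ξ₂.vec p)) m (ξ₃.vec m)
      = - (2 * mvfderiv 𝓘(ℝ, E) (fun p => ξ₁.form p (ξ₂.vec p)) m (ξ₃.vec m)) := by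
    rw [neg_mul_eq_neg_mul, ← mvfderiv_fun_const_mul (hd ξ₁ ξ₂)]
    congr 2
    funext p
    rw [iso ξ₁ ξ₂ p]
    ring
  change ξ₃.form m (VectorField.mlieBracket 𝓘(ℝ, E) ξ₁.vec ξ₂.vec m) +
    (lieDeriv ξ₁.vec ξ₂.form m (ξ₃.vec m) - lieDeriv ξ₂.vec ξ₁.form m (ξ₃.vec m)
      - (1 / 2 : ℝ) * mvfderiv 𝓘(ℝ, E)
        (fun p => ξ₂.form p (ξ₁.vec p) - ξ₁.form p (ξ₂.vec p)) m (ξ₃.vec m)) = 0 at h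
  rw [lieDeriv_apply, lieDeriv_apply, e] at h
  simp only [diffTwo, key, key2]
  change 2 * mvfderiv 𝓘(ℝ, E) (fun p => ξ₂.form p (ξ₃.vec p)) m (ξ₁.vec m)
    - 2 * mvfderiv 𝓘(ℝ, E) (fun p => ξ₁.form p (ξ₃.vec p)) m (ξ₂.vec m)
    + 2 * mvfderiv 𝓘(ℝ, E) (fun p => ξ₁.form p (ξ₂.vec p)) m (ξ₃.vec m) - _ + _ - _ = 0
  linarith

lemma omega_mem_horTwoCocycles : omega D ∈ horTwoCocycles D :=
  ⟨⟨omega_mem_dTwoForms D, omega_apply_of_anchor_eq_zero D,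
    fun m ξ₁ ξ₂ ξ₃ _ => diffTwo_omega D ξ₁ ξ₂ ξ₃ m⟩, diffTwo_omega D⟩

end Cocycle

/-! ### Lie brackets as commutators, and brackets of related vector fields -/

section Bracket

variable {E : Type*} [NormedAddCommGroup E] [NormedSpace ℝ E] [FiniteDimensional ℝ E]
variable {M : Type*} [TopologicalSpace M] [ChartedSpace E M] [IsManifold 𝓘(ℝ, E) ∞ M]
variable {E' : Type*} [NormedAddCommGroup E'] [NormedSpace ℝ E']

open VectorField

lemma two_le_infty : (2 : WithTop ℕ∞) ≤ ∞ := by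
  change ((2 : ℕ∞) : WithTop ℕ∞) ≤ ((⊤ : ℕ∞) : WithTop ℕ∞)
  exact WithTop.coe_le_coe.2 le_top

/-- The Lie bracket acts on functions as a commutator. -/
lemma mvfderiv_mlieBracket {f : M → E'} {x : M} {V W : Π p : M, TangentSpace 𝓘(ℝ, E) p}
    (hf : ContMDiffAt 𝓘(ℝ, E) 𝓘(ℝ, E') ∞ f x)
    (hV : MDifferentiableAt 𝓘(ℝ, E) 𝓘(ℝ, E).tangent (fun p => Bundle.TotalSpace.mk' E p (V p)) x)
    (hW : MDifferentiableAt 𝓘(ℝ, E) 𝓘(ℝ, E).tangent (fun p => Bundle.TotalSpace.mk' E p (W p)) x)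
    (hVf : MDifferentiableAt 𝓘(ℝ, E) 𝓘(ℝ, E') (fun p => mvfderiv 𝓘(ℝ, E) f p (V p)) x)
    (hWf : MDifferentiableAt 𝓘(ℝ, E) 𝓘(ℝ, E') (fun p => mvfderiv 𝓘(ℝ, E) f p (W p)) x) :
    mvfderiv 𝓘(ℝ, E) f x (mlieBracket 𝓘(ℝ, E) V W x)
      = mvfderiv 𝓘(ℝ, E) (fun p => mvfderiv 𝓘(ℝ, E) f p (W p)) x (V x)
        - mvfderiv 𝓘(ℝ, E) (fun p => mvfderiv 𝓘(ℝ, E) f p (V p)) x (W x) := by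
  -- The inverse chart `g` transports the identity to the model space, where it is
  -- `fderiv_apply_lieBracket` for the pulled back fields `V'` and `W'`.
  set φ := extChartAt 𝓘(ℝ, E) x with hφ
  set g : E → M := fun y => φ.symm y with hg
  set z : E := φ x with hz
  have hgz : g z = x := extChartAt_to_inv x
  have htgt : ∀ᶠ y in 𝓝 z, y ∈ φ.target := extChartAt_target_mem_nhds x
  have hinv : ∀ y ∈ φ.target, (mfderiv 𝓘(ℝ, E) 𝓘(ℝ, E) g y).IsInvertible := fun y hy => by
    have := isInvertible_mfderivWithin_extChartAt_symm (I := 𝓘(ℝ, E)) hy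
    rwa [modelWithCornersSelf_coe, Set.range_id, mfderivWithin_univ] at this
  have hgs : ∀ y ∈ φ.target, ContMDiffAt 𝓘(ℝ, E) 𝓘(ℝ, E) ∞ g y := fun y hy =>
    (contMDiffOn_extChartAt_symm x).contMDiffAt ((isOpen_extChartAt_target x).mem_nhds hy)
  have hzt : z ∈ φ.target := mem_extChartAt_target x
  have hgd : ∀ y ∈ φ.target, MDifferentiableAt 𝓘(ℝ, E) 𝓘(ℝ, E) g y := fun y hy =>
    (hgs y hy).mdifferentiableAt (by simp)
  set V' : E → E := mpullback 𝓘(ℝ, E) 𝓘(ℝ, E) g V with hV'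
  set W' : E → E := mpullback 𝓘(ℝ, E) 𝓘(ℝ, E) g W with hW'
  have hpull : ∀ (U : Π p : M, TangentSpace 𝓘(ℝ, E) p), ∀ y ∈ φ.target,
      mfderiv 𝓘(ℝ, E) 𝓘(ℝ, E) g y (mpullback 𝓘(ℝ, E) 𝓘(ℝ, E) g U y) = U (g y) := fun U y hy => by
    rw [mpullback_apply]
    exact (hinv y hy).self_apply_inverse _
  have hbr : mlieBracket 𝓘(ℝ, E) V' W' z
      = mpullback 𝓘(ℝ, E) 𝓘(ℝ, E) g (mlieBracket 𝓘(ℝ, E) V W) z := by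
    have : IsManifold 𝓘(ℝ, E) (minSmoothness ℝ 2) M := by
      rw [minSmoothness_of_isRCLikeNormedField]
      infer_instance
    have : IsManifold 𝓘(ℝ, E) (minSmoothness ℝ 2) E := by
      rw [minSmoothness_of_isRCLikeNormedField]
      infer_instance
    exact (mpullback_mlieBracket (hgz.symm ▸ hV) (hgz.symm ▸ hW) (hgs z hzt)
      (by rw [minSmoothness_of_isRCLikeNormedField]; exact two_le_infty)).symm
  have hA : ∀ (k : M → E') (U : Π p : M, TangentSpace 𝓘(ℝ, E) p), ∀ y ∈ φ.target,
      MDifferentiableAt 𝓘(ℝ, E) 𝓘(ℝ, E') k (g y) →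
      fderiv ℝ (k ∘ g) y (mpullback 𝓘(ℝ, E) 𝓘(ℝ, E) g U y)
        = mvfderiv 𝓘(ℝ, E) k (g y) (U (g y)) := fun k U y hy hk => by
    rw [← mfderiv_eq_fderiv]
    have := mfderiv_comp_apply y hk (hgd y hy) (mpullback 𝓘(ℝ, E) 𝓘(ℝ, E) g U y)
    rw [hpull U y hy] at this
    exact this
  have hdiff : ∀ (U : Π p : M, TangentSpace 𝓘(ℝ, E) p),
      MDifferentiableAt 𝓘(ℝ, E) 𝓘(ℝ, E).tangent (fun p => Bundle.TotalSpace.mk' E p (U p)) x →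
      DifferentiableAt ℝ (mpullback 𝓘(ℝ, E) 𝓘(ℝ, E) g U : E → E) z := fun U hU => by
    have h1 := MDifferentiableAt.mpullback_vectorField (f := g) (x₀ := z) (V := U) (n := ∞)
      (by rwa [hgz]) (hgs z hzt) (hinv z hzt) two_le_infty
    exact ((contMDiff_snd_tangentBundle_modelSpace E 𝓘(ℝ, E)).contMDiffAt.mdifferentiableAt
      one_ne_zero |>.comp _ h1).differentiableAt
  have hfd : ∀ᶠ y in 𝓝 z, MDifferentiableAt 𝓘(ℝ, E) 𝓘(ℝ, E') f (g y) := by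
    have h1 : ∀ᶠ p in 𝓝 x, ContMDiffAt 𝓘(ℝ, E) 𝓘(ℝ, E') 1 f p :=
      (contMDiffAt_iff_contMDiffAt_nhds (by simp)).1 (hf.of_le (one_le_two.trans two_le_infty))
    have h2 : Filter.Tendsto g (𝓝 z) (𝓝 x) := by
      have := (hgd z hzt).continuousAt
      rwa [ContinuousAt, hgz] at this
    exact (h2.eventually h1).mono fun y hy => hy.mdifferentiableAt one_ne_zero
  have hfg : ContDiffAt ℝ ∞ (f ∘ g) z := by
    rw [← contMDiffAt_iff_contDiffAt]
    exact ContMDiffAt.comp z (by rwa [hgz]) (hgs z hzt)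
  -- An equality of germs at `z` is needed, since these functions are differentiated once more.
  have hcomp : ∀ (U : Π p : M, TangentSpace 𝓘(ℝ, E) p),
      (fun y => fderiv ℝ (f ∘ g) y (mpullback 𝓘(ℝ, E) 𝓘(ℝ, E) g U y))
        =ᶠ[𝓝 z] (fun p => mvfderiv 𝓘(ℝ, E) f p (U p)) ∘ g := fun U => by
    filter_upwards [hfd, htgt] with y hy hyt using hA f U y hyt hy
  have main := fderiv_apply_lieBracket (V := V') (W := W') hfg
    (by rw [minSmoothness_of_isRCLikeNormedField]; exact two_le_infty) (hdiff W hW) (hdiff V hV)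
  have e0 : lieBracket ℝ V' W' z
      = mpullback 𝓘(ℝ, E) 𝓘(ℝ, E) g (mlieBracket 𝓘(ℝ, E) V W) z := by
    rw [← hbr]
    refine (congrFun lieBracketWithin_univ z).symm.trans
      ((congrFun mlieBracketWithin_eq_lieBracketWithin z).symm.trans ?_)
    exact congrFun mlieBracketWithin_univ z
  rw [e0, hA f _ z hzt hfd.self_of_nhds, (hcomp W).fderiv_eq, (hcomp V).fderiv_eq,
    hA _ V z hzt (by rwa [hgz]), hA _ W z hzt (by rwa [hgz]), hgz] at main
  exact main

lemma mvfderiv_congr {f g : M → E'} {x : M} (h : f =ᶠ[𝓝 x] g) (v : TangentSpace 𝓘(ℝ, E) x) :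
    mvfderiv 𝓘(ℝ, E) f x v = mvfderiv 𝓘(ℝ, E) g x v :=
  congrArg (fun A : E →L[ℝ] E' => A v) h.mfderiv_eq

/-- The derivative of a smooth function along a smooth vector field is smooth. -/
lemma contMDiffAt_mvfderiv_apply {f : M → E'} {x : M} (hf : ContMDiffAt 𝓘(ℝ, E) 𝓘(ℝ, E') ∞ f x)
    (X : VectorFields E M) :
    ContMDiffAt 𝓘(ℝ, E) 𝓘(ℝ, E') ∞ (fun p => mvfderiv 𝓘(ℝ, E) f p (X p)) x := by
  have h1 : ContMDiffAt 𝓘(ℝ, E) (𝓘(ℝ, E').prod 𝓘(ℝ, E')) ∞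
      (fun p => Bundle.TotalSpace.mk' E' (E := fun q : E' => TangentSpace 𝓘(ℝ, E') q) (f p)
        (mfderiv 𝓘(ℝ, E) 𝓘(ℝ, E') f p (X p))) x :=
    ContMDiffAt.clm_apply_of_inCoordinates (b₁ := fun p => p) (b₂ := f)
      (hf.mfderiv_const (m := ∞) (by simp)) (X.contMDiff x) hf
  exact (contMDiff_snd_tangentBundle_modelSpace E' 𝓘(ℝ, E')).contMDiffAt.comp x h1

variable {F : Type*} [NormedAddCommGroup F] [NormedSpace ℝ F] [FiniteDimensional ℝ F]
variable {L : Type*} [TopologicalSpace L] [ChartedSpace F L] [IsManifold 𝓘(ℝ, F) ∞ L]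

lemma mvfderiv_comp_map {ι : L → M} {x : L} {f : M → E'}
    (hf : MDifferentiableAt 𝓘(ℝ, E) 𝓘(ℝ, E') f (ι x))
    (hι : MDifferentiableAt 𝓘(ℝ, F) 𝓘(ℝ, E) ι x) (u : TangentSpace 𝓘(ℝ, F) x) :
    mvfderiv 𝓘(ℝ, F) (fun p => f (ι p)) x u
      = mvfderiv 𝓘(ℝ, E) f (ι x) (mfderiv 𝓘(ℝ, F) 𝓘(ℝ, E) ι x u) :=
  mfderiv_comp_apply x hf hι u

/-- The Lie brackets of `ι`-related vector fields are `ι`-related. -/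
lemma mfderiv_mlieBracket_of_related {ι : L → M} (hι : ContMDiff 𝓘(ℝ, F) 𝓘(ℝ, E) ∞ ι)
    {V W : VectorFields F L} {X Y : VectorFields E M}
    (hV : ∀ x, mfderiv 𝓘(ℝ, F) 𝓘(ℝ, E) ι x (V x) = X (ι x))
    (hW : ∀ x, mfderiv 𝓘(ℝ, F) 𝓘(ℝ, E) ι x (W x) = Y (ι x)) (x : L) :
    mfderiv 𝓘(ℝ, F) 𝓘(ℝ, E) ι x (mlieBracket 𝓘(ℝ, F) V W x)
      = mlieBracket 𝓘(ℝ, E) X Y (ι x) := by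
  -- A chart has injective derivative at `ι x`, so both sides may be compared after applying it.
  -- There the commutator formula holds on `M` for `f` and on `L` for `f ∘ ι`, and relatedness
  -- matches the terms.
  set f : M → E := fun q => extChartAt 𝓘(ℝ, E) (ι x) q with hfdef
  have hf : ContMDiffAt 𝓘(ℝ, E) 𝓘(ℝ, E) ∞ f (ι x) := contMDiffAt_extChartAt
  have hfd : ∀ᶠ q in 𝓝 (ι x), MDifferentiableAt 𝓘(ℝ, E) 𝓘(ℝ, E) f q :=
    ((contMDiffAt_iff_contMDiffAt_nhds (by simp)).1
      (hf.of_le (one_le_two.trans two_le_infty))).mono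
      fun q hq => hq.mdifferentiableAt one_ne_zero
  have hιd : ∀ p, MDifferentiableAt 𝓘(ℝ, F) 𝓘(ℝ, E) ι p := fun p =>
    (hι p).mdifferentiableAt (by simp)
  have hinj : Function.Injective (mvfderiv 𝓘(ℝ, E) f (ι x)) :=
    (isInvertible_mfderiv_extChartAt (I := 𝓘(ℝ, E)) (mem_extChartAt_source (ι x))).injective
  have hrel : ∀ (U : VectorFields F L) (Z : VectorFields E M),
      (∀ x, mfderiv 𝓘(ℝ, F) 𝓘(ℝ, E) ι x (U x) = Z (ι x)) →
      (fun p => mvfderiv 𝓘(ℝ, F) (fun p => f (ι p)) p (U p))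
        =ᶠ[𝓝 x] fun p => (fun q => mvfderiv 𝓘(ℝ, E) f q (Z q)) (ι p) := fun U Z h => by
    filter_upwards [hι.continuous.continuousAt.eventually hfd] with p hp
    rw [mvfderiv_comp_map hp (hιd p), h]
  have hfι : ContMDiffAt 𝓘(ℝ, F) 𝓘(ℝ, E) ∞ (fun p => f (ι p)) x := hf.comp x (hι x)
  have hd : ∀ Z : VectorFields E M,
      MDifferentiableAt 𝓘(ℝ, E) 𝓘(ℝ, E) (fun q => mvfderiv 𝓘(ℝ, E) f q (Z q)) (ι x) :=
    fun Z => (contMDiffAt_mvfderiv_apply hf Z).mdifferentiableAt (by simp)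
  have hd' : ∀ U : VectorFields F L, MDifferentiableAt 𝓘(ℝ, F) 𝓘(ℝ, E)
      (fun p => mvfderiv 𝓘(ℝ, F) (fun p => f (ι p)) p (U p)) x :=
    fun U => (contMDiffAt_mvfderiv_apply hfι U).mdifferentiableAt (by simp)
  apply hinj
  rw [mvfderiv_mlieBracket hf X.mdifferentiableAt Y.mdifferentiableAt (hd X) (hd Y),
    ← mvfderiv_comp_map hfd.self_of_nhds (hιd x),
    mvfderiv_mlieBracket hfι V.mdifferentiableAt W.mdifferentiableAt (hd' V) (hd' W),
    mvfderiv_congr (hrel W Y hW), mvfderiv_congr (hrel V X hV),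
    mvfderiv_comp_map (hd Y) (hιd x), mvfderiv_comp_map (hd X) (hιd x), hV, hW]

end Bracket

open Bundle

/-! ### Smoothness of sections of homomorphism bundles -/

section Hom

variable {F : Type*} [NormedAddCommGroup F] [NormedSpace ℝ F] [FiniteDimensional ℝ F]
variable {L : Type*} [TopologicalSpace L] [ChartedSpace F L] [IsManifold 𝓘(ℝ, F) ∞ L]
variable {F₁ : Type*} [NormedAddCommGroup F₁] [NormedSpace ℝ F₁] [FiniteDimensional ℝ F₁]
  {V₁ : L → Type*} [TopologicalSpace (TotalSpace F₁ V₁)]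
  [∀ x, AddCommGroup (V₁ x)] [∀ x, Module ℝ (V₁ x)]
  [∀ x : L, TopologicalSpace (V₁ x)]
  [FiberBundle F₁ V₁] [VectorBundle ℝ F₁ V₁]
  [ContMDiffVectorBundle ∞ F₁ V₁ 𝓘(ℝ, F)]
variable {F₂ : Type*} [NormedAddCommGroup F₂] [NormedSpace ℝ F₂]
  {V₂ : L → Type*} [TopologicalSpace (TotalSpace F₂ V₂)]
  [∀ x, AddCommGroup (V₂ x)] [∀ x, Module ℝ (V₂ x)]
  [∀ x : L, TopologicalSpace (V₂ x)] [∀ x, IsTopologicalAddGroup (V₂ x)]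
  [∀ x, ContinuousSMul ℝ (V₂ x)]
  [FiberBundle F₂ V₂] [VectorBundle ℝ F₂ V₂]
  [ContMDiffVectorBundle ∞ F₂ V₂ 𝓘(ℝ, F)]

/-- In a basis `b` of the finite-dimensional source, `A x` is the sum of the `b.coord i ⊗ A x (b
i)`, and each summand is a fixed continuous linear image of `A x (b i)`. -/
lemma contMDiffAt_clm_of_apply {E' : Type*} [NormedAddCommGroup E'] [NormedSpace ℝ E']
    {A : L → F₁ →L[ℝ] E'} {x₀ : L}
    (h : ∀ v, ContMDiffAt 𝓘(ℝ, F) 𝓘(ℝ, E') ∞ (fun x => A x v) x₀) :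
    ContMDiffAt 𝓘(ℝ, F) 𝓘(ℝ, F₁ →L[ℝ] E') ∞ A x₀ := by
  let b := Module.finBasis ℝ F₁
  have : A = fun x => ∑ i, ContinuousLinearMap.smulRightL ℝ F₁ E'
      (LinearMap.toContinuousLinearMap (b.coord i)) (A x (b i)) := by
    funext x
    ext v
    conv_lhs => rw [← b.sum_repr v, map_sum]
    rw [sum_apply]
    refine Finset.sum_congr rfl fun i _ => ?_
    rw [map_smul]
    rfl
  rw [this]
  refine ContMDiffAt.sum fun i _ => ?_
  exact (ContinuousLinearMap.contMDiff _).contMDiffAt.comp x₀ (h (b i))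

/-- A section of a bundle of homomorphisms is smooth if it maps smooth sections to smooth
sections. -/
lemma contMDiffAt_hom_of_apply {φ : ∀ x : L, V₁ x →L[ℝ] V₂ x} {x₀ : L}
    (h : ∀ s : ∀ x : L, V₁ x,
      ContMDiffAt 𝓘(ℝ, F) (𝓘(ℝ, F).prod 𝓘(ℝ, F₁)) ∞ (fun x => TotalSpace.mk' F₁ x (s x)) x₀ →
      ContMDiffAt 𝓘(ℝ, F) (𝓘(ℝ, F).prod 𝓘(ℝ, F₂)) ∞
        (fun x => TotalSpace.mk' F₂ x (φ x (s x))) x₀) :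
    ContMDiffAt 𝓘(ℝ, F) (𝓘(ℝ, F).prod 𝓘(ℝ, F₁ →L[ℝ] F₂)) ∞
      (fun x => TotalSpace.mk' (F₁ →L[ℝ] F₂) (E := fun x => V₁ x →L[ℝ] V₂ x) x (φ x)) x₀ := by
  rw [contMDiffAt_hom_bundle]
  refine ⟨contMDiffAt_id, contMDiffAt_clm_of_apply fun v => ?_⟩
  let e := trivializationAt F₁ V₁ x₀
  have hx : x₀ ∈ e.baseSet := FiberBundle.mem_baseSet_trivializationAt F₁ V₁ x₀
  -- The section that is constantly `v` in the trivialization; its image under `φ`, read in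
  -- coordinates, is the coordinate matrix of `φ` applied to `v`.
  have hs : ContMDiffAt 𝓘(ℝ, F) (𝓘(ℝ, F).prod 𝓘(ℝ, F₁)) ∞
      (fun x => TotalSpace.mk' F₁ x (e.symmL ℝ x v)) x₀ := by
    rw [e.contMDiffAt_section_iff hx]
    refine contMDiffAt_const (c := v) |>.congr_of_eventuallyEq ?_
    filter_upwards [e.open_baseSet.mem_nhds hx] with y hy
    rw [e.symmL_apply hy, e.apply_mk_symm hy]
  have h2 := (contMDiffAt_section _).1 (h _ hs)
  refine h2.congr_of_eventuallyEq ?_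
  filter_upwards [e.open_baseSet.mem_nhds hx,
    (trivializationAt F₂ V₂ x₀).open_baseSet.mem_nhds
      (FiberBundle.mem_baseSet_trivializationAt F₂ V₂ x₀)] with y hy hy2
  simp only [ContinuousLinearMap.inCoordinates, ContinuousLinearMap.comp_apply]
  rw [Trivialization.continuousLinearMapAt_apply, Trivialization.linearMapAt_apply, if_pos hy2]

end Hom
-- Smoothness of vector fields related through an immersion
section Immersion

variable {E : Type*} [NormedAddCommGroup E] [NormedSpace ℝ E] [FiniteDimensional ℝ E]
variable {M : Type*} [TopologicalSpace M] [ChartedSpace E M] [IsManifold 𝓘(ℝ, E) ∞ M]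
variable {F : Type*} [NormedAddCommGroup F] [NormedSpace ℝ F] [FiniteDimensional ℝ F]
variable {L : Type*} [TopologicalSpace L] [ChartedSpace F L] [IsManifold 𝓘(ℝ, F) ∞ L]

/-- Near a point at which they are invertible, a smooth family of endomorphisms has a smooth
inverse. -/
lemma exists_contMDiffAt_left_inverse {A : L → F →L[ℝ] F} {x₀ : L}
    (hA : ContMDiffAt 𝓘(ℝ, F) 𝓘(ℝ, F →L[ℝ] F) ∞ A x₀) (h : IsUnit (A x₀)) :
    ∃ B : L → F →L[ℝ] F, ContMDiffAt 𝓘(ℝ, F) 𝓘(ℝ, F →L[ℝ] F) ∞ B x₀ ∧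
      ∀ᶠ x in 𝓝 x₀, (∀ v, B x (A x v) = v) ∧ ∀ v, A x (B x v) = v := by
  have := FiniteDimensional.complete ℝ F
  obtain ⟨a, ha⟩ := h
  -- `Ring.inverse` is zero off the units, so the identities are claimed only on the neighbourhood
  -- of `x₀` where `A x` is a unit.
  refine ⟨fun x => Ring.inverse (A x), ?_, ?_⟩
  · have h1 : ContDiffAt ℝ ∞ Ring.inverse (A x₀) := ha ▸ contDiffAt_ringInverse ℝ a
    exact h1.contMDiffAt.comp x₀ hA
  · have h2 : ∀ᶠ x in 𝓝 x₀, IsUnit (A x) :=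
      hA.continuousAt.eventually (ha ▸ Units.nhds a)
    filter_upwards [h2] with x hx
    exact ⟨fun v => congrArg (fun T : F →L[ℝ] F => T v) (Ring.inverse_mul_cancel _ hx),
      fun v => congrArg (fun T : F →L[ℝ] F => T v) (Ring.mul_inverse_cancel _ hx)⟩

/-- A vector field that is related to a smooth vector field by an immersion is smooth. -/
lemma contMDiffAt_of_related {ι : L → M} {x₀ : L} (hι : ContMDiff 𝓘(ℝ, F) 𝓘(ℝ, E) ∞ ι)
    (himm : Function.Injective (mfderiv 𝓘(ℝ, F) 𝓘(ℝ, E) ι x₀))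
    {V : ∀ x : L, TangentSpace 𝓘(ℝ, F) x} (X : VectorFields E M)
    (hV : ∀ x, mfderiv 𝓘(ℝ, F) 𝓘(ℝ, E) ι x (V x) = X (ι x)) :
    ContMDiffAt 𝓘(ℝ, F) (𝓘(ℝ, F).prod 𝓘(ℝ, F)) ∞ (fun x => TotalSpace.mk' F x (V x)) x₀ := by
  let eL := trivializationAt F (TangentSpace 𝓘(ℝ, F) : L → Type _) x₀
  let eM := trivializationAt E (TangentSpace 𝓘(ℝ, E) : M → Type _) (ι x₀)
  have hxL : x₀ ∈ eL.baseSet := FiberBundle.mem_baseSet_trivializationAt _ _ _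
  have hxM : ι x₀ ∈ eM.baseSet := FiberBundle.mem_baseSet_trivializationAt _ _ _
  have hA : ContMDiffAt 𝓘(ℝ, F) 𝓘(ℝ, F →L[ℝ] E) ∞
      (inTangentCoordinates 𝓘(ℝ, F) 𝓘(ℝ, E) id ι (mfderiv 𝓘(ℝ, F) 𝓘(ℝ, E) ι) x₀) x₀ :=
    (hι x₀).mfderiv_const (by simp)
  set A := inTangentCoordinates 𝓘(ℝ, F) 𝓘(ℝ, E) id ι (mfderiv 𝓘(ℝ, F) 𝓘(ℝ, E) ι) x₀
  have hnhds : ∀ᶠ x in 𝓝 x₀, x ∈ eL.baseSet ∧ ι x ∈ eM.baseSet :=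
    (Filter.Eventually.and (eL.open_baseSet.mem_nhds hxL)
      (hι.continuous.continuousAt.eventually (eM.open_baseSet.mem_nhds hxM)))
  have hAapp : ∀ x, x ∈ eL.baseSet → ∀ v : TangentSpace 𝓘(ℝ, F) x,
      A x (eL.continuousLinearMapAt ℝ x v)
      = eM.continuousLinearMapAt ℝ (ι x) (mfderiv 𝓘(ℝ, F) 𝓘(ℝ, E) ι x v) := fun x hx v =>
    congrArg (fun w => eM.continuousLinearMapAt ℝ (ι x) (mfderiv 𝓘(ℝ, F) 𝓘(ℝ, E) ι x w))
      (eL.symmL_continuousLinearMapAt hx v)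
  have hinj : Function.Injective (A x₀) := by
    rw [injective_iff_map_eq_zero]
    intro w hw
    rw [← eL.continuousLinearMapAt_symmL (R := ℝ) hxL w] at hw ⊢
    rw [hAapp x₀ hxL] at hw
    have h1 := eM.symmL_continuousLinearMapAt (R := ℝ) hxM
      (mfderiv 𝓘(ℝ, F) 𝓘(ℝ, E) ι x₀ (eL.symmL ℝ x₀ w))
    rw [hw, map_zero] at h1
    rw [himm (h1.symm.trans (map_zero _).symm), map_zero]
  -- A fixed left inverse of `A x₀`. The endomorphism `B₀ ∘ A x` is the identity at `x₀`, hence has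
  -- a smooth inverse `B x` nearby, and in coordinates `V = B x (B₀ (X (ι x)))`.
  obtain ⟨B₀, hB₀⟩ := (A x₀ : F →ₗ[ℝ] E).exists_leftInverse_of_injective
    (LinearMap.ker_eq_bot.2 hinj)
  have hC : ContMDiffAt 𝓘(ℝ, F) 𝓘(ℝ, F →L[ℝ] F) ∞
      (fun x => (LinearMap.toContinuousLinearMap B₀).comp (A x)) x₀ :=
    contMDiffAt_const.clm_comp hA
  have hunit : (LinearMap.toContinuousLinearMap B₀).comp (A x₀) = 1 := by
    ext v
    exact congrArg (fun T : F →ₗ[ℝ] F => T v) hB₀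
  obtain ⟨B, hB, hBinv⟩ := exists_contMDiffAt_left_inverse hC (hunit ▸ isUnit_one)
  rw [contMDiffAt_section]
  have hX := ((contMDiffAt_section _).1 (X.contMDiff (ι x₀))).comp x₀ (hι x₀)
  refine (hB.clm_apply ((contMDiffAt_const (c := LinearMap.toContinuousLinearMap B₀)).clm_apply
    hX)).congr_of_eventuallyEq ?_
  filter_upwards [hnhds, hBinv] with x hx hBx
  have h1 := hBx.1 (eL.continuousLinearMapAt ℝ x (V x))
  rw [ContinuousLinearMap.comp_apply, hAapp x hx.1, hV, eL.continuousLinearMapAt_apply_of_mem ℝ hx.1,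
    eM.continuousLinearMapAt_apply_of_mem ℝ hx.2] at h1
  exact h1.symm

end Immersion

/-! ### Smooth coefficients with respect to a spanning family of vector fields -/

section Frame

variable {F : Type*} [NormedAddCommGroup F] [NormedSpace ℝ F] [FiniteDimensional ℝ F]
variable {L : Type*} [TopologicalSpace L] [ChartedSpace F L] [IsManifold 𝓘(ℝ, F) ∞ L]

/-- A smooth vector field is a smooth linear combination of smooth vector fields which span the
tangent space. -/
lemma exists_contMDiffAt_coeff {n : ℕ} {x₀ : L} {V : Fin n → ∀ x : L, TangentSpace 𝓘(ℝ, F) x}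
    (hV : ∀ i, ContMDiffAt 𝓘(ℝ, F) (𝓘(ℝ, F).prod 𝓘(ℝ, F)) ∞
      (fun x => TotalSpace.mk' F x (V i x)) x₀)
    (hspan : ∀ u : TangentSpace 𝓘(ℝ, F) x₀, ∃ c : Fin n → ℝ, ∑ i, c i • V i x₀ = u)
    {s : ∀ x : L, TangentSpace 𝓘(ℝ, F) x}
    (hs : ContMDiffAt 𝓘(ℝ, F) (𝓘(ℝ, F).prod 𝓘(ℝ, F)) ∞
      (fun x => TotalSpace.mk' F x (s x)) x₀) :
    ∃ c : Fin n → L → ℝ, (∀ i, ContMDiffAt 𝓘(ℝ, F) 𝓘(ℝ, ℝ) ∞ (c i) x₀) ∧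
      ∀ᶠ x in 𝓝 x₀, ∑ i, c i x • V i x = s x := by
  let e := trivializationAt F (TangentSpace 𝓘(ℝ, F) : L → Type _) x₀
  have hx₀ : x₀ ∈ e.baseSet := FiberBundle.mem_baseSet_trivializationAt _ _ _
  -- The map from coefficients to linear combinations, read in the trivialization.
  let Q : L → (Fin n → ℝ) →L[ℝ] F := fun x =>
    ∑ i, (ContinuousLinearMap.proj i).smulRight (e ⟨x, V i x⟩).2
  have hQapp : ∀ x c, Q x c = ∑ i, c i • (e ⟨x, V i x⟩).2 := fun x c => by
    simp [Q, sum_apply]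
  have hQe : ∀ x ∈ e.baseSet, ∀ c, Q x c = e.continuousLinearMapAt ℝ x (∑ i, c i • V i x) :=
    fun x hx c => by
    rw [hQapp, map_sum]
    refine Finset.sum_congr rfl fun i _ => ?_
    rw [map_smul, e.continuousLinearMapAt_apply_of_mem ℝ hx]
  have hQ : ContMDiffAt 𝓘(ℝ, F) 𝓘(ℝ, (Fin n → ℝ) →L[ℝ] F) ∞ Q x₀ := by
    refine contMDiffAt_clm_of_apply fun c => ?_
    simp only [hQapp]
    refine ContMDiffAt.sum fun i _ => ?_
    have hc : ContMDiffAt 𝓘(ℝ, F) 𝓘(ℝ, ℝ) ∞ (fun _ : L => c i) x₀ := contMDiffAt_const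
    exact hc.smul ((contMDiffAt_section _).1 (hV i))
  have hsurj : Function.Surjective (Q x₀) := fun w => by
    obtain ⟨c, hc⟩ := hspan (e.symmL ℝ x₀ w)
    exact ⟨c, by rw [hQe x₀ hx₀, hc, e.continuousLinearMapAt_symmL hx₀]⟩
  -- The `V i` may be linearly dependent; a fixed right inverse of `Q x₀` selects coefficients. As
  -- `Q x ∘ R₀` is invertible near `x₀` with smooth inverse `B x`, the choice `R₀ (B x (s x))` is
  -- smooth.
  obtain ⟨R₀, hR₀⟩ := (Q x₀ : (Fin n → ℝ) →ₗ[ℝ] F).exists_rightInverse_of_surjective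
    (LinearMap.range_eq_top.2 hsurj)
  have hC : ContMDiffAt 𝓘(ℝ, F) 𝓘(ℝ, F →L[ℝ] F) ∞
      (fun x => (Q x).comp (LinearMap.toContinuousLinearMap R₀)) x₀ :=
    hQ.clm_comp contMDiffAt_const
  have hunit : (Q x₀).comp (LinearMap.toContinuousLinearMap R₀) = 1 := by
    ext v
    exact congrArg (fun T : F →ₗ[ℝ] F => T v) hR₀
  obtain ⟨B, hB, hBinv⟩ := exists_contMDiffAt_left_inverse hC (hunit ▸ isUnit_one)
  have hc : ContMDiffAt 𝓘(ℝ, F) 𝓘(ℝ, Fin n → ℝ) ∞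
      (fun x => LinearMap.toContinuousLinearMap R₀ (B x (e ⟨x, s x⟩).2)) x₀ :=
    contMDiffAt_const.clm_apply (hB.clm_apply ((contMDiffAt_section _).1 hs))
  refine ⟨fun i x => LinearMap.toContinuousLinearMap R₀ (B x (e ⟨x, s x⟩).2) i,
    contMDiffAt_pi_space.1 hc, ?_⟩
  filter_upwards [hBinv, e.open_baseSet.mem_nhds hx₀] with x hBx hx
  have h1 := hBx.2 (e ⟨x, s x⟩).2
  rw [ContinuousLinearMap.comp_apply, hQe x hx, ← e.continuousLinearMapAt_apply_of_mem ℝ hx]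
    at h1
  have h2 := congrArg (e.symmL ℝ x) h1
  rwa [e.symmL_continuousLinearMapAt hx, e.symmL_continuousLinearMapAt hx,
    e.continuousLinearMapAt_apply_of_mem ℝ hx] at h2

end Frame

/-! ### Global sections of a Dirac structure -/

section Sections

variable {E : Type*} [NormedAddCommGroup E] [NormedSpace ℝ E] [FiniteDimensional ℝ E]
variable {M : Type*} [TopologicalSpace M] [ChartedSpace E M] [IsManifold 𝓘(ℝ, E) ∞ M]
variable (D : DiracStructure E M)

lemma genTangent_sum {n : ℕ} {m : M} (c : Fin n → ℝ) (X : Fin n → TangentSpace 𝓘(ℝ, E) m)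
    (α : Fin n → (TangentSpace 𝓘(ℝ, E) m →L[ℝ] ℝ)) :
    ((∑ i, c i • X i, ∑ i, c i • α i) : GenTangent E m)
      = ∑ i, c i • ((X i, α i) : GenTangent E m) := by
  classical
  suffices h : ∀ s : Finset (Fin n), ((∑ i ∈ s, c i • X i, ∑ i ∈ s, c i • α i) : GenTangent E m)
      = ∑ i ∈ s, c i • ((X i, α i) : GenTangent E m) from h Finset.univ
  intro s
  induction s using Finset.induction_on with
  | empty => rfl
  | insert i s hi h =>
    rw [Finset.sum_insert hi, Finset.sum_insert hi, Finset.sum_insert hi, ← h]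
    rfl

/-- Around every point, finitely many global sections span the Dirac structure. -/
lemma exists_sections_span [T2Space M] (m₀ : M) :
    ∃ ξ : Fin (Module.finrank ℝ E) → DiracSection D, ∀ᶠ m in 𝓝 m₀, ∀ a : D.fiber m,
      ∃ c : Fin (Module.finrank ℝ E) → ℝ, ∑ i, c i • (ξ i).eval m = a := by
  obtain ⟨U, hU, hm₀, X, α, hX, hα, hspan⟩ := D.exists_frame m₀
  -- Multiplying the local frame by a bump function with closed support in `U` makes it global; it
  -- is unchanged near `m₀`, where the bump function equals 1.
  obtain ⟨f, hf, -⟩ := (SmoothBumpFunction.nhds_basis_support (I := 𝓘(ℝ, E))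
    (hU.mem_nhds hm₀)).mem_iff.1 (hU.mem_nhds hm₀)
  have hfs : ContMDiff 𝓘(ℝ, E) 𝓘(ℝ, ℝ) ∞ f := f.contMDiff
  refine ⟨fun i =>
    { vec := ⟨fun m => f m • X i m, 
        ContMDiffOn.smul_section_of_tsupport hfs.contMDiffOn hU hf (hX i)⟩
      form := ⟨fun m => f m • α i m, 
        ContMDiffOn.smul_section_of_tsupport hfs.contMDiffOn hU hf (hα i)⟩
      mem := fun m => ?_ }, ?_⟩
  · change f m • ((X i m, α i m) : GenTangent E m) ∈ D.fiber m
    by_cases hm : m ∈ U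
    · refine Submodule.smul_mem _ _ ?_
      rw [← (hspan m hm).2]
      exact Submodule.subset_span ⟨i, rfl⟩
    · rw [image_eq_zero_of_notMem_tsupport fun h => hm (hf h), zero_smul]
      exact zero_mem _
  · filter_upwards [f.eventuallyEq_one, hU.mem_nhds hm₀] with m h1 hm a
    have ha : a.1 ∈ Submodule.span ℝ
        (Set.range fun i => ((X i m, α i m) : GenTangent E m)) := (hspan m hm).2.symm ▸ a.2
    rw [Submodule.mem_span_range_iff_exists_fun] at ha
    obtain ⟨c, hc⟩ := ha
    refine ⟨c, Subtype.ext ?_⟩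
    rw [← hc, Submodule.coe_sum]
    refine Finset.sum_congr rfl fun i _ => ?_
    change c i • (f m • ((X i m, α i m) : GenTangent E m)) = _
    rw [h1, Pi.one_apply, one_smul]

variable {D} in
/-- Linear combinations of sections. -/
def DiracSection.linComb {n : ℕ} (c : Fin n → ℝ) (ξ : Fin n → DiracSection D) :
    DiracSection D where
  vec := ⟨fun m => ∑ i, c i • (ξ i).vec m, ContMDiff.sum_section fun i _ =>
    (ξ i).vec.contMDiff.const_smul_section⟩
  form := ⟨fun m => ∑ i, c i • (ξ i).form m, ContMDiff.sum_section fun i _ =>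
    (ξ i).form.contMDiff.const_smul_section⟩
  mem m := by
    have h : ∑ i, c i • (((ξ i).vec m, (ξ i).form m) : GenTangent E m) ∈ D.fiber m :=
      Submodule.sum_mem _ fun i _ => Submodule.smul_mem _ _ ((ξ i).mem m)
    rwa [← genTangent_sum] at h

/-- Every element of a Dirac structure is the value of a section. -/
lemma exists_section_eval_eq [T2Space M] {m : M} (a : D.fiber m) :
    ∃ ξ : DiracSection D, ξ.eval m = a := by
  obtain ⟨ξ, hξ⟩ := exists_sections_span D m
  obtain ⟨c, hc⟩ := hξ.self_of_nhds a
  refine ⟨DiracSection.linComb c ξ, ?_⟩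
  rw [← hc]
  apply Subtype.ext
  rw [Submodule.coe_sum]
  exact genTangent_sum c (fun i => (ξ i).vec m) (fun i => (ξ i).form m)

end Sections

/-! ### Restriction of sections and descent of forms to a leaf -/

section LeafForms

open Bundle

variable {E : Type*} [NormedAddCommGroup E] [NormedSpace ℝ E] [FiniteDimensional ℝ E]
variable {M : Type*} [TopologicalSpace M] [ChartedSpace E M] [IsManifold 𝓘(ℝ, E) ∞ M]
variable {F : Type*} [NormedAddCommGroup F] [NormedSpace ℝ F] [FiniteDimensional ℝ F]
variable {L : Type*} [TopologicalSpace L] [ChartedSpace F L] [IsManifold 𝓘(ℝ, F) ∞ L]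
variable {D : DiracStructure E M} {ι : L → M}

/-- The vector field `V` on `L` is `ι`-related to the vector field underlying the section `ξ`. -/
def IsRestriction (ι : L → M) (ξ : DiracSection D) (V : VectorFields F L) : Prop :=
  ∀ x, mfderiv 𝓘(ℝ, F) 𝓘(ℝ, E) ι x (V x) = anchor D (ι x) (ξ.eval (ι x))

namespace IsLeaf

variable (hι : IsLeaf (F := F) D ι)
include hι

/-- The tangent spaces of a leaf lift linearly to the Dirac structure. -/
lemma exists_lift (x : L) : ∃ l : TangentSpace 𝓘(ℝ, F) x →ₗ[ℝ] D.fiber (ι x),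
    ∀ u, anchor D (ι x) (l u) = mfderiv 𝓘(ℝ, F) 𝓘(ℝ, E) ι x u := by
  let g : TangentSpace 𝓘(ℝ, F) x →ₗ[ℝ] LinearMap.range (anchor D (ι x)) :=
    LinearMap.codRestrict _ (mfderiv 𝓘(ℝ, F) 𝓘(ℝ, E) ι x : _ →ₗ[ℝ] _)
      fun u => (hι.tangent x _).1 ⟨u, rfl⟩
  obtain ⟨l, hl⟩ := Module.projective_lifting_property (anchor D (ι x)).rangeRestrict g
    (anchor D (ι x)).surjective_rangeRestrict
  exact ⟨l, fun u => congrArg Subtype.val (congrArg (fun T => T u) hl)⟩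

/-- Sections of the Dirac structure restrict to vector fields on the leaves. -/
lemma exists_restriction (ξ : DiracSection D) : ∃ V : VectorFields F L, IsRestriction ι ξ V := by
  choose V hV using fun x => (hι.tangent x (ξ.vec (ι x))).2 ⟨ξ.eval (ι x), rfl⟩
  exact ⟨⟨V, fun x => contMDiffAt_of_related hι.contMDiff (hι.immersion x) ξ.vec hV⟩, hV⟩

/-- Every tangent vector of a leaf is a value of the restriction of a section. -/
lemma exists_restriction_eq [T2Space M] {x : L} (u : TangentSpace 𝓘(ℝ, F) x) :
    ∃ (ξ : DiracSection D) (V : VectorFields F L), IsRestriction ι ξ V ∧ V x = u := by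
  obtain ⟨a, ha⟩ := (hι.tangent x _).1 ⟨u, rfl⟩
  obtain ⟨ξ, hξ⟩ := exists_section_eval_eq D a
  obtain ⟨V, hV⟩ := hι.exists_restriction ξ
  exact ⟨ξ, V, hV, hι.immersion x (by rw [hV x, hξ, ha])⟩

/-- Vector fields on a leaf are locally combinations of restrictions of sections. -/
lemma exists_frame [T2Space M] (x₀ : L) : ∃ (n : ℕ) (ξ : Fin n → DiracSection D)
    (V : Fin n → VectorFields F L), (∀ i, IsRestriction ι (ξ i) (V i)) ∧
    ∀ s : ∀ x : L, TangentSpace 𝓘(ℝ, F) x,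
      ContMDiffAt 𝓘(ℝ, F) (𝓘(ℝ, F).prod 𝓘(ℝ, F)) ∞ (fun x => TotalSpace.mk' F x (s x)) x₀ →
      ∃ c : Fin n → L → ℝ, (∀ i, ContMDiffAt 𝓘(ℝ, F) 𝓘(ℝ, ℝ) ∞ (c i) x₀) ∧
        ∀ᶠ x in 𝓝 x₀, ∑ i, c i x • V i x = s x := by
  obtain ⟨ξ, hξ⟩ := exists_sections_span D (ι x₀)
  choose V hV using fun i => hι.exists_restriction (ξ i)
  -- The number of fields is `dim M`, which may exceed the dimension of the leaf; only spanning at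
  -- `x₀` is needed.
  refine ⟨_, ξ, V, hV, fun s hs => exists_contMDiffAt_coeff (fun i => (V i).contMDiff x₀) ?_ hs⟩
  intro u
  obtain ⟨a, ha⟩ := (hι.tangent x₀ _).1 ⟨u, rfl⟩
  obtain ⟨c, hc⟩ := hξ.self_of_nhds a
  refine ⟨c, hι.immersion x₀ ?_⟩
  rw [← ha, ← hc, map_sum, map_sum]
  refine Finset.sum_congr rfl fun i _ => ?_
  rw [map_smul, map_smul, hV i x₀]

/-- A horizontal 1-form on the Dirac structure induces a 1-form on every leaf. -/
lemma exists_induced_oneForm [T2Space M] {θ : FibreOneForms D} (hθ : θ ∈ dOneForms D)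
    (hor : ∀ m, ∀ a : D.fiber m, anchor D m a = 0 → θ m a = 0) :
    ∃ τ : OneForms F L, ∀ (x : L) (u : TangentSpace 𝓘(ℝ, F) x) (a : D.fiber (ι x)),
      anchor D (ι x) a = mfderiv 𝓘(ℝ, F) 𝓘(ℝ, E) ι x u → τ x u = θ (ι x) a := by
  -- The lifts are chosen point by point, with no regularity in `x`. Since `θ` kills `ker ρ`, its
  -- value does not depend on the lift, so smoothness can be tested with lifts coming from sections.
  choose l hl using hι.exists_lift
  have hfin : ∀ x : L, FiniteDimensional ℝ (TangentSpace 𝓘(ℝ, F) x) := fun _ =>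
    inferInstanceAs (FiniteDimensional ℝ F)
  have hT2 : ∀ x : L, T2Space (TangentSpace 𝓘(ℝ, F) x) := fun _ => inferInstanceAs (T2Space F)
  let τ : ∀ x : L, TangentSpace 𝓘(ℝ, F) x →L[ℝ] ℝ := fun x =>
    LinearMap.toContinuousLinearMap (θ (ι x) ∘ₗ l x)
  have hτ : ∀ (x : L) (u : TangentSpace 𝓘(ℝ, F) x) (a : D.fiber (ι x)),
      anchor D (ι x) a = mfderiv 𝓘(ℝ, F) 𝓘(ℝ, E) ι x u → τ x u = θ (ι x) a := by
    intro x u a ha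
    change θ (ι x) (l x u) = θ (ι x) a
    rw [← sub_eq_zero, ← map_sub]
    exact hor _ _ (by rw [map_sub, hl, ha, sub_self])
  refine ⟨⟨τ, fun x₀ => contMDiffAt_hom_of_apply (V₂ := fun _ => ℝ) fun s hs => ?_⟩, hτ⟩
  refine (contMDiffAt_section _).2 ?_
  change ContMDiffAt 𝓘(ℝ, F) 𝓘(ℝ, ℝ) ∞ (fun x => τ x (s x)) x₀
  obtain ⟨n, ξ, V, hV, hspan⟩ := hι.exists_frame x₀
  obtain ⟨c, hc, hcs⟩ := hspan s hs
  have h1 : ContMDiffAt 𝓘(ℝ, F) 𝓘(ℝ, ℝ) ∞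
      (fun x => ∑ i, c i x * θ (ι x) ((ξ i).eval (ι x))) x₀ :=
    ContMDiffAt.sum fun i _ => (hc i).mul ((hθ (ξ i) (ι x₀)).comp x₀ (hι.contMDiff x₀))
  refine h1.congr_of_eventuallyEq ?_
  filter_upwards [hcs] with x hx
  rw [← hx, map_sum]
  refine Finset.sum_congr rfl fun i _ => ?_
  rw [map_smul, hτ x (V i x) _ (hV i x).symm, smul_eq_mul]

/-- A 2-form on the Dirac structure that is annihilated by the kernel of the anchor induces a
2-form on every leaf. -/
lemma exists_induced_twoForm [T2Space M] {η : FibreTwoForms D} (hη : η ∈ dTwoForms D)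
    (hor : ∀ m, ∀ a : D.fiber m, anchor D m a = 0 → ∀ b, η m a b = 0) :
    ∃ σ : TwoTensors F L, IsInduced η ι σ := by
  choose l hl using hι.exists_lift
  have hfin : ∀ x : L, FiniteDimensional ℝ (TangentSpace 𝓘(ℝ, F) x) := fun _ =>
    inferInstanceAs (FiniteDimensional ℝ F)
  have hT2 : ∀ x : L, T2Space (TangentSpace 𝓘(ℝ, F) x) := fun _ => inferInstanceAs (T2Space F)
  -- `hor` concerns the first slot; antisymmetry carries it to the second.
  have hswap : ∀ m (a b : D.fiber m), η m a b = - η m b a := fun m a b => by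
    have h := hη.1 m (a + b)
    simp only [map_add, LinearMap.add_apply, hη.1 m a, hη.1 m b] at h
    linarith
  let σ : ∀ x : L, TangentSpace 𝓘(ℝ, F) x →L[ℝ] TangentSpace 𝓘(ℝ, F) x →L[ℝ] ℝ := fun x =>
    LinearMap.toContinuousLinearMap (LinearMap.toContinuousLinearMap.toLinearMap ∘ₗ
      ((η (ι x)).compl₁₂ (l x) (l x)))
  have hσ : ∀ (x : L) (u v : TangentSpace 𝓘(ℝ, F) x) (a b : D.fiber (ι x)),
      anchor D (ι x) a = mfderiv 𝓘(ℝ, F) 𝓘(ℝ, E) ι x u →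
      anchor D (ι x) b = mfderiv 𝓘(ℝ, F) 𝓘(ℝ, E) ι x v → σ x u v = η (ι x) a b := by
    intro x u v a b ha hb
    change η (ι x) (l x u) (l x v) = η (ι x) a b
    have h1 : η (ι x) (l x u - a) (l x v) = 0 :=
      hor _ _ (by rw [map_sub, hl, ha, sub_self]) _
    have h2 : η (ι x) (l x v - b) a = 0 :=
      hor _ _ (by rw [map_sub, hl, hb, sub_self]) _
    rw [map_sub, LinearMap.sub_apply] at h1 h2
    rw [hswap _ (l x v) a, hswap _ b a] at h2
    linarith
  refine ⟨⟨σ, fun x₀ => contMDiffAt_hom_of_apply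
    (V₂ := fun x => TangentSpace 𝓘(ℝ, F) x →L[ℝ] ℝ) fun s hs =>
    contMDiffAt_hom_of_apply (V₂ := fun _ => ℝ) fun t ht => ?_⟩, hσ⟩
  refine (contMDiffAt_section _).2 ?_
  change ContMDiffAt 𝓘(ℝ, F) 𝓘(ℝ, ℝ) ∞ (fun x => σ x (s x) (t x)) x₀
  obtain ⟨n, ξ, V, hV, hspan⟩ := hι.exists_frame x₀
  obtain ⟨c, hc, hcs⟩ := hspan s hs
  obtain ⟨d, hd, hdt⟩ := hspan t ht
  have h1 : ContMDiffAt 𝓘(ℝ, F) 𝓘(ℝ, ℝ) ∞ (fun x => ∑ i, ∑ j,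
      c i x * (d j x * η (ι x) ((ξ i).eval (ι x)) ((ξ j).eval (ι x)))) x₀ :=
    ContMDiffAt.sum fun i _ => ContMDiffAt.sum fun j _ => (hc i).mul
      ((hd j).mul ((hη.2 (ξ i) (ξ j) (ι x₀)).comp x₀ (hι.contMDiff x₀)))
  refine h1.congr_of_eventuallyEq ?_
  filter_upwards [hcs, hdt] with x hx hx'
  rw [← hx, ← hx', map_sum (σ x), sum_apply]
  refine Finset.sum_congr rfl fun i _ => ?_
  rw [map_sum]
  refine Finset.sum_congr rfl fun j _ => ?_
  rw [map_smul, map_smul, smul_apply,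
    hσ x (V i x) (V j x) _ _ (hV i x).symm (hV j x).symm, smul_eq_mul, smul_eq_mul]
  ring

end IsLeaf

end LeafForms

/-! ### Tensoriality of the de Rham differential -/

section Tensoriality

variable {E : Type*} [NormedAddCommGroup E] [NormedSpace ℝ E] [FiniteDimensional ℝ E]
variable {M : Type*} [TopologicalSpace M] [ChartedSpace E M] [IsManifold 𝓘(ℝ, E) ∞ M]

open VectorField

lemma dOneForm_swap (θ : OneForms E M) (X Y : VectorFields E M) (m : M) :
    dOneForm θ X Y m = - dOneForm θ Y X m := by
  have h := mlieBracket_swap_apply (I := 𝓘(ℝ, E)) (V := X) (W := Y) (x := m)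
  simp only [dOneForm, h, map_neg]
  ring

/-- Cartan's formula `dθ(X, ·) = L_X θ - d(θ(X))` exhibits the dependence on the last argument as a
linear form at `m`. -/
lemma dOneForm_congr_right (θ : OneForms E M) (X : VectorFields E M) {Y Y' : VectorFields E M}
    {m : M} (h : Y m = Y' m) : dOneForm θ X Y m = dOneForm θ X Y' m := by
  have key : ∀ Z : VectorFields E M, dOneForm θ X Z m
      = lieDeriv X θ m (Z m) - mvfderiv 𝓘(ℝ, E) (fun p => θ p (X p)) m (Z m) := fun Z => by
    rw [lieDeriv_apply, dOneForm]
    ring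
  rw [key, key, h]

/-- The differential of a 1-form is tensorial. -/
lemma dOneForm_congr (θ : OneForms E M) {X X' Y Y' : VectorFields E M} {m : M}
    (hX : X m = X' m) (hY : Y m = Y' m) : dOneForm θ X Y m = dOneForm θ X' Y' m := by
  rw [dOneForm_congr_right θ X hY, dOneForm_swap, dOneForm_congr_right θ Y' hX, dOneForm_swap,
    neg_neg]

/-- The contraction of a covariant 2-tensor with a vector field. -/
def contract (η : TwoTensors E M) (X : VectorFields E M) : OneForms E M :=
  ⟨fun p => η p (X p), fun p => (η.contMDiff p).clm_bundle_apply (X.contMDiff p)⟩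

lemma contract_apply (η : TwoTensors E M) (X : VectorFields E M) (m : M) :
    contract η X m = η m (X m) := rfl

variable {η : TwoTensors E M} (hη : ∀ m v, η m v v = 0)
include hη

lemma twoTensor_swap (m : M) (u v : TangentSpace 𝓘(ℝ, E) m) : η m u v = - η m v u := by
  have h := hη m (u + v)
  rw [map_add, map_add, add_apply, add_apply, hη, hη] at h
  linarith

lemma mvfderiv_twoTensor_swap (X Y : VectorFields E M) (m : M) (v : TangentSpace 𝓘(ℝ, E) m) :
    mvfderiv 𝓘(ℝ, E) (fun p => η p (X p) (Y p)) m v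
      = - mvfderiv 𝓘(ℝ, E) (fun p => η p (Y p) (X p)) m v := by
  rw [neg_eq_neg_one_mul, ← mvfderiv_fun_const_mul (mdifferentiableAt_twoTensor_apply η Y X m)]
  congr 2
  funext p
  rw [twoTensor_swap hη, neg_one_mul]

/-- Cyclic symmetry brings each argument in turn to the last slot, where tensoriality is
established. -/
lemma dTwoForm_rotate (X Y Z : VectorFields E M) (m : M) :
    dTwoForm η X Y Z m = dTwoForm η Y Z X m := by
  have h1 := mlieBracket_swap_apply (I := 𝓘(ℝ, E)) (V := Y) (W := X) (x := m)
  have h2 := mlieBracket_swap_apply (I := 𝓘(ℝ, E)) (V := Z) (W := X) (x := m)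
  simp only [dTwoForm, h1, h2, map_neg, neg_apply]
  rw [mvfderiv_twoTensor_swap hη Y X, mvfderiv_twoTensor_swap hη Z X]
  ring

/-- As a function of the last argument, the differential is `L_X (i_Y η) - L_Y (i_X η) + d(η(X, Y))
- i_[X,Y] η`, a sum of 1-forms evaluated at `m`. -/
lemma dTwoForm_congr_right (X Y : VectorFields E M) {Z Z' : VectorFields E M}
    {m : M} (h : Z m = Z' m) : dTwoForm η X Y Z m = dTwoForm η X Y Z' m := by
  have key : ∀ W : VectorFields E M, dTwoForm η X Y W m
      = lieDeriv X (contract η Y) m (W m) - lieDeriv Y (contract η X) m (W m)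
        + mvfderiv 𝓘(ℝ, E) (fun p => η p (X p) (Y p)) m (W m)
        - η m (mlieBracket 𝓘(ℝ, E) X Y m) (W m) := fun W => by
    rw [lieDeriv_apply, lieDeriv_apply, dTwoForm,
      twoTensor_swap hη m (mlieBracket 𝓘(ℝ, E) X W m),
      twoTensor_swap hη m (mlieBracket 𝓘(ℝ, E) Y W m)]
    simp only [contract_apply]
    ring
  rw [key, key, h]

/-- The differential of a 2-form is tensorial. -/
lemma dTwoForm_congr {X X' Y Y' Z Z' : VectorFields E M} {m : M}
    (hX : X m = X' m) (hY : Y m = Y' m) (hZ : Z m = Z' m) :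
    dTwoForm η X Y Z m = dTwoForm η X' Y' Z' m := by
  rw [dTwoForm_congr_right hη X Y hZ, dTwoForm_rotate hη, dTwoForm_congr_right hη Y Z' hX,
    dTwoForm_rotate hη, dTwoForm_congr_right hη Z' X' hY, dTwoForm_rotate hη]

end Tensoriality

/-! ### Comparison of `d_D` with the de Rham differential on a leaf -/

section LeafCohomology

variable {E : Type*} [NormedAddCommGroup E] [NormedSpace ℝ E] [FiniteDimensional ℝ E]
variable {M : Type*} [TopologicalSpace M] [ChartedSpace E M] [IsManifold 𝓘(ℝ, E) ∞ M]
variable {F : Type*} [NormedAddCommGroup F] [NormedSpace ℝ F] [FiniteDimensional ℝ F]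
variable {L : Type*} [TopologicalSpace L] [ChartedSpace F L] [IsManifold 𝓘(ℝ, F) ∞ L]
variable {D : DiracStructure E M} {ι : L → M}

/-- The vector part of the Courant bracket is by definition the Lie bracket of the vector parts, so
this is the bracket property of `ι`-related fields. -/
lemma IsRestriction.anchor_bracket (hι : ContMDiff 𝓘(ℝ, F) 𝓘(ℝ, E) ∞ ι)
    {ξ ζ : DiracSection D} {V W : VectorFields F L} (hV : IsRestriction ι ξ V)
    (hW : IsRestriction ι ζ W) (x : L) :
    anchor D (ι x) (bracket ξ ζ (ι x)) = mfderiv 𝓘(ℝ, F) 𝓘(ℝ, E) ι x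
      (VectorField.mlieBracket 𝓘(ℝ, F) V W x) :=
  (mfderiv_mlieBracket_of_related hι hV hW x).symm

/-- Restriction to a leaf intertwines the differentials of 1-forms. -/
lemma dOneForm_restriction (hι : ContMDiff 𝓘(ℝ, F) 𝓘(ℝ, E) ∞ ι)
    {θ : FibreOneForms D} (hθ : θ ∈ dOneForms D) {τ : OneForms F L}
    (hτ : ∀ (x : L) (u : TangentSpace 𝓘(ℝ, F) x) (a : D.fiber (ι x)),
      anchor D (ι x) a = mfderiv 𝓘(ℝ, F) 𝓘(ℝ, E) ι x u → τ x u = θ (ι x) a)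
    {ξ ζ : DiracSection D} {V W : VectorFields F L} (hV : IsRestriction ι ξ V)
    (hW : IsRestriction ι ζ W) (x : L) :
    dOneForm τ V W x = diffOne θ ξ ζ (ι x) := by
  -- The function `τ(V)` is the pullback of `θ(ξ)` along `ι`, so this is the chain rule.
  have key : ∀ {ξ : DiracSection D} {V : VectorFields F L} (_ : IsRestriction ι ξ V)
      (u : TangentSpace 𝓘(ℝ, F) x),
      mvfderiv 𝓘(ℝ, F) (fun p => τ p (V p)) x u
        = mvfderiv 𝓘(ℝ, E) (fun p => θ p (ξ.eval p)) (ι x)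
          (mfderiv 𝓘(ℝ, F) 𝓘(ℝ, E) ι x u) := fun {ξ V} hV u => by
    rw [← mvfderiv_comp_map ((hθ ξ).mdifferentiable (by simp) _)
      (hι.mdifferentiable (by simp) x)]
    congr 2
    funext p
    exact hτ p _ _ (hV p).symm
  rw [dOneForm, diffOne, key hV, key hW, hV x, hW x, hτ x _ _ (hV.anchor_bracket hι hW x)]

/-- Restriction to a leaf intertwines the differentials of 2-forms. -/
lemma dTwoForm_restriction (hι : ContMDiff 𝓘(ℝ, F) 𝓘(ℝ, E) ∞ ι)
    {η : FibreTwoForms D} (hη : η ∈ dTwoForms D) {σ : TwoTensors F L} (hσ : IsInduced η ι σ)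
    {ξ₁ ξ₂ ξ₃ : DiracSection D} {V₁ V₂ V₃ : VectorFields F L} (h₁ : IsRestriction ι ξ₁ V₁)
    (h₂ : IsRestriction ι ξ₂ V₂) (h₃ : IsRestriction ι ξ₃ V₃) (x : L) :
    dTwoForm σ V₁ V₂ V₃ x = diffTwo η ξ₁ ξ₂ ξ₃ (ι x) := by
  have key : ∀ {ξ ζ : DiracSection D} {V W : VectorFields F L} (_ : IsRestriction ι ξ V)
      (_ : IsRestriction ι ζ W) (u : TangentSpace 𝓘(ℝ, F) x),
      mvfderiv 𝓘(ℝ, F) (fun p => σ p (V p) (W p)) x u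
        = mvfderiv 𝓘(ℝ, E) (fun p => η p (ξ.eval p) (ζ.eval p)) (ι x)
          (mfderiv 𝓘(ℝ, F) 𝓘(ℝ, E) ι x u) := fun {ξ ζ V W} hV hW u => by
    rw [← mvfderiv_comp_map ((hη.2 ξ ζ).mdifferentiable (by simp) _)
      (hι.mdifferentiable (by simp) x)]
    congr 2
    funext p
    exact hσ p _ _ _ _ (hV p).symm (hW p).symm
  rw [dTwoForm, diffTwo, key h₂ h₃, key h₁ h₃, key h₁ h₂, h₁ x, h₂ x, h₃ x,
    hσ x _ _ _ _ (h₁.anchor_bracket hι h₂ x) (h₃ x).symm,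
    hσ x _ _ _ _ (h₁.anchor_bracket hι h₃ x) (h₂ x).symm,
    hσ x _ _ _ _ (h₂.anchor_bracket hι h₃ x) (h₁ x).symm]

/-- The 2-form induced on a leaf by a cocycle is closed. -/
lemma IsLeaf.mem_closedTwoForms [T2Space M] (hι : IsLeaf (F := F) D ι) {η : FibreTwoForms D}
    (hη : η ∈ horTwoCocycles D) {σ : TwoTensors F L} (hσ : IsInduced η ι σ) :
    σ ∈ closedTwoForms F L := by
  have halt : ∀ x v, σ x v v = 0 := fun x v => by
    obtain ⟨a, ha⟩ := (hι.tangent x _).1 ⟨v, rfl⟩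
    rw [hσ x v v a a ha ha, hη.1.1.1]
  refine ⟨halt, fun X Y Z x => ?_⟩
  -- By tensoriality, `X`, `Y`, `Z` may be replaced by restrictions of sections with the same values
  -- at `x`.
  obtain ⟨ξ₁, V₁, h₁, e₁⟩ := hι.exists_restriction_eq (X x)
  obtain ⟨ξ₂, V₂, h₂, e₂⟩ := hι.exists_restriction_eq (Y x)
  obtain ⟨ξ₃, V₃, h₃, e₃⟩ := hι.exists_restriction_eq (Z x)
  rw [← dTwoForm_congr halt e₁ e₂ e₃,
    dTwoForm_restriction hι.contMDiff hη.1.1 hσ h₁ h₂ h₃, hη.2]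

/-- The 2-form induced on a leaf by a horizontal coboundary is exact. -/
lemma IsLeaf.deRhamClass_eq_zero [T2Space M] (hι : IsLeaf (F := F) D ι)
    {η : horTwoCocycles D} (h : horClass η = 0) {σ : closedTwoForms F L}
    (hσ : IsInduced η.1 ι σ.1) : deRhamClass σ = 0 := by
  obtain ⟨θ, hθ, hd⟩ := (Submodule.Quotient.mk_eq_zero _).1 h
  -- Horizontality of the primitive `θ` is what lets it descend to the leaf.
  obtain ⟨τ, hτ⟩ := hι.exists_induced_oneForm hθ.1 hθ.2.1
  refine (Submodule.Quotient.mk_eq_zero _).2 ⟨τ, fun X Y x => ?_⟩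
  obtain ⟨ξ, V, hV, eV⟩ := hι.exists_restriction_eq (X x)
  obtain ⟨ζ, W, hW, eW⟩ := hι.exists_restriction_eq (Y x)
  rw [← dOneForm_congr τ eV eW, dOneForm_restriction hι.contMDiff hθ.1 hτ hV hW, ← hd, ← eV, ← eW]
  exact hσ x _ _ _ _ (hV x).symm (hW x).symm

end LeafCohomology

end Dirac

end

/-! ### The main theorem -/

theorem mainTheorem5
    {E : Type*} [NormedAddCommGroup E] [NormedSpace ℝ E] [FiniteDimensional ℝ E]
    {M : Type*} [TopologicalSpace M] [T2Space M] [SecondCountableTopology M]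
    [ChartedSpace E M] [IsManifold 𝓘(ℝ, E) ∞ M]
    (D : Dirac.DiracStructure E M) :
    ∃ h : Dirac.omega D ∈ Dirac.horTwoCocycles D,
      ∀ {F : Type*} [NormedAddCommGroup F] [NormedSpace ℝ F] [FiniteDimensional ℝ F]
        {L : Type*} [TopologicalSpace L] [ChartedSpace F L] [IsManifold 𝓘(ℝ, F) ∞ L]
        (ι : L → M), Dirac.IsLeaf (F := F) D ι →
        ∃ σ : Dirac.closedTwoForms F L, Dirac.IsInduced (Dirac.omega D) ι σ.1 ∧
          (Dirac.horClass ⟨Dirac.omega D, h⟩ = 0 → Dirac.deRhamClass σ = 0) := by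
  refine ⟨Dirac.omega_mem_horTwoCocycles D, fun ι hι => ?_⟩
  obtain ⟨σ, hσ⟩ := hι.exists_induced_twoForm (Dirac.omega_mem_dTwoForms D)
    (Dirac.omega_apply_of_anchor_eq_zero D)
  exact ⟨⟨σ, hι.mem_closedTwoForms (Dirac.omega_mem_horTwoCocycles D) hσ⟩, hσ,
    fun h => hι.deRhamClass_eq_zero h hσ⟩
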